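/- **Setting.** Let $T$ be a square matrix with entries in $\{0,1\}$ that is primitive (some power $T^M$, $M\ge 1$, has only positive entries), let $\Sigma_T$ be the two-sided subshift of finite type $\{(x_i)_{i\in\mathbb Z}: T_{x_i,x_{i+1}}=1 \text{ for all } i\}$ with left shift $\sigma$ and the metric $d(x,y)=2^{-k}$, where $k$ is the largest integer with $x_i=y_i$ for all $|i|<k$ (and $d(x,x)=0$), and let $[x]_n=\{y\in\Sigma_T: x_i=y_i \text{ for } 0\le i\le n-1\}$. Let $d\ge 1$. For $\mathcal A:\Sigma_T\to GL_d(\mathbb R)$ and $n\ge 0$ put $\mathcal A^n(x)=\mathcal A(\sigma^{n-1}x)\cdots\mathcal A(x)$ and $\mathcal A^{-n}(x)=\mathcal A^n(\sigma^{-n}x)^{-1}$. **1-typical cocycles.** $\mathcal A$ is fiber-bunched if for some $\alpha\in(0,1]$ it is $\alpha$-Hölder and $\|\mathcal A(x)\|\,\|\mathcal A(x)^{-1}\|\,(1/2)^{\alpha}<1$ for all $x$ (Euclidean operator norm). A homoclinic point of a periodic point $p$ is a point $z\neq p$ such that $z_i=p_i$ for all sufficiently large $i$ and for all sufficiently small (negative)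 $i$. Its holonomy loop is $\psi_z=H^s_{z,p}\circ H^u_{p,z}$, where $H^s_{x,y}=\lim_{n\to\infty}\mathcal A^n(y)^{-1}\mathcal A^n(x)$ and $H^u_{x,y}=\lim_{n\to-\infty}\mathcal A^n(y)^{-1}\mathcal A^n(x)$. A fiber-bunched cocycle $\mathcal A$ is 1-typical if there are a periodic point $p$ and a homoclinic point $z$ of $p$ such that $P=\mathcal A^{\mathrm{per}(p)}(p)$ has simple eigenvalues of distinct moduli and, $v_1,\dots,v_d$ being the eigenvectors of $P$, for all $I,J\subseteq\{1,\dots,d\}$ with $|I|+|J|\le d$ the family consisting of $\psi_z(v_i)$, $i\in I$, and $v_j$, $j\in J$, is linearly independent. **Proximality.** Let $\rho(\mathsf u,\mathsf v)=\min\{\measuredangle(u,v),\measuredangle(u,-v)\}$ be the angular metric on $\mathbb P^{d-1}$, write $\rho(\mathsf v,\mathsf S)=\inf_{\mathsf w\in \mathsf S}\rho(\mathsf v,\mathsf w)$ (so $\rho(\mathsf v,\emptyset)=\infty$) and $\mathcal C(\mathsf S,\delta)=\{\mathsf v:\rho(\mathsf v,\mathsf S)\le\delta\}$. A map $g\in GL_d(\mathbb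 R)$ is proximal if it has a unique eigenvalue of maximal modulus and this eigenvalue has algebraic multiplicity one; then $\mathsf v_g\in\mathbb P^{d-1}$ is its eigenline and $\mathsf V_g^<\subset\mathbb P^{d-1}$ is the projectivization of the $g$-invariant hyperplane complementary to it. For $\varepsilon>0$, a proximal $g$, with projective action $\mathsf g$, is $\varepsilon$-proximal if $\rho(\mathsf v_g,\mathsf V_g^<)\ge 2\varepsilon$ and, with $\mathsf K=\mathbb P^{d-1}\setminus\mathcal C(\mathsf V_g^<,\varepsilon)$, one has $\mathsf g(\mathsf K)\subseteq\mathcal C(\mathsf v_g,\varepsilon)$ and $\sup_{\mathsf u\ne\mathsf v\in\mathsf K}\rho(\mathsf g\mathsf u,\mathsf g\mathsf v)/\rho(\mathsf u,\mathsf v)\le\varepsilon$. **Theorem.** Let $\mathcal A:\Sigma_T\to GL_d(\mathbb R)$ be a 1-typical cocycle. Then there is $\tau_0=\tau_0(\mathcal A)>0$ such that for every $\tau\in(0,\tau_0)$ there is $k=k(\tau)\in\mathbb N$ with the following property: for every $x\in\Sigma_T$ and $n\in\mathbb N$ there are a point $q\in\Sigma_T$ and an integer $n_q\ge 1$ with $\sigma^{n_q}q=q$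 and $n_q\in[n,n+k]$ such that 1. $\mathcal A^{n_q}(q)$ is $\tau$-proximal, and 2. there is $j\in\mathbb N$ such that $\sigma^jq\in[x]_n$. -/

import Mathlib

noncomputable section

namespace ProximalCocycle

open Filter Topology

/-! ### Two-sided subshifts of finite type -/

/-- The subshift `Σ_T`: bi-infinite words over `{0, …, N - 1}` all of whose transitions are
allowed by the matrix `T`. -/
abbrev Subshift {N : ℕ} (T : Matrix (Fin N) (Fin N) ℕ) : Type :=
  {x : ℤ → Fin N // ∀ i, T (x i) (x (i + 1)) = 1}

section Base

variable {N : ℕ} {T : Matrix (Fin N) (Fin N) ℕ}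

/-- The left shift `σ`, as a permutation of `Σ_T`; so `σ ^ n` makes sense for `n : ℕ` and `n : ℤ`. -/
def shift : Equiv.Perm (Subshift T) where
  toFun x := ⟨fun i => x.1 (i + 1), fun i => x.2 (i + 1)⟩
  invFun x := ⟨fun i => x.1 (i - 1), fun i => by
    have h := x.2 (i - 1)
    rw [sub_add_cancel] at h
    simpa using h⟩
  left_inv x := by ext i; simp
  right_inv x := by ext i; simp

/-- The metric of `Σ_T`: `d(x, y) = 2 ^ (-k)`, where `k` is the largest integer such that
`x i = y i` for all `|i| < k`, that is, the least `|i|` with `x i ≠ y i`; and `d(x, x) = 0`. -/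
def subshiftDist (x y : Subshift T) : ℝ :=
  open scoped Classical in
  if x = y then 0 else (1 / 2 : ℝ) ^ sInf {k : ℕ | ∃ i : ℤ, i.natAbs = k ∧ x.1 i ≠ y.1 i}

/-- The cylinder `[x]_n`. -/
def cylinder (x : Subshift T) (n : ℕ) : Set (Subshift T) :=
  {y | ∀ i : ℕ, i < n → x.1 i = y.1 i}

/-- The local stable set of `x`. -/
def localStableSet (x : Subshift T) : Set (Subshift T) :=
  {y | ∀ i : ℤ, 0 ≤ i → x.1 i = y.1 i}

/-- The local unstable set of `x`. -/
def localUnstableSet (x : Subshift T) : Set (Subshift T) :=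
  {y | ∀ i : ℤ, i ≤ 0 → x.1 i = y.1 i}

/-- The stable set of `x`. -/
def stableSet (x : Subshift T) : Set (Subshift T) :=
  {y | ∃ n : ℕ, (shift ^ n) y ∈ localStableSet ((shift ^ n) x)}

/-- The unstable set of `x`. -/
def unstableSet (x : Subshift T) : Set (Subshift T) :=
  {y | ∃ n : ℕ, (shift ^ (-(n : ℤ))) y ∈ localUnstableSet ((shift ^ (-(n : ℤ))) x)}

/-- The homoclinic points of `p`. -/
def homoclinicPoints (p : Subshift T) : Set (Subshift T) :=
  (stableSet p ∩ unstableSet p) \ {p}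

end Base

/-! ### Cocycles, fiber-bunching and holonomies -/

/-- `ℝ^d` with its Euclidean norm. -/
abbrev Euc (d : ℕ) : Type := EuclideanSpace ℝ (Fin d)

/-- `GL_d(ℝ)`, as the group of invertible linear maps of `ℝ^d` (the product is composition). -/
abbrev GLd (d : ℕ) : Type := Euc d ≃L[ℝ] Euc d

/-- An element of `GL_d(ℝ)` in the normed algebra of linear maps of `ℝ^d` (operator norm). -/
abbrev GLd.toOp {d : ℕ} (g : GLd d) : Euc d →L[ℝ] Euc d := g.toContinuousLinearMap

section Cocycles

variable {N : ℕ} {T : Matrix (Fin N) (Fin N) ℕ} {d : ℕ}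

/-- The product `A^n(x) = A(σ^(n-1) x) ⋯ A(σ x) A(x)`, with `A^0(x) = id`. -/
def iter (A : Subshift T → GLd d) : ℕ → Subshift T → GLd d
  | 0, _ => 1
  | n + 1, x => A ((shift ^ n) x) * iter A n x

/-- The backward product `A^(-n)(x) = (A^n(σ^(-n) x))⁻¹`. -/
def iterNeg (A : Subshift T → GLd d) (n : ℕ) (x : Subshift T) : GLd d :=
  (iter A n ((shift ^ (-(n : ℤ))) x))⁻¹

/-- `A` is fiber-bunched: it is `α`-Hölder for some `α ∈ (0, 1]` such that
`‖A(x)‖ ‖A(x)⁻¹‖ (1/2)^α < 1` for all `x`. -/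
def IsFiberBunched (A : Subshift T → GLd d) : Prop :=
  ∃ α : ℝ, 0 < α ∧ α ≤ 1 ∧
    (∃ C : ℝ, ∀ x y, ‖(A x).toOp - (A y).toOp‖ ≤ C * subshiftDist x y ^ α) ∧
    ∀ x, ‖(A x).toOp‖ * ‖((A x)⁻¹).toOp‖ * (1 / 2 : ℝ) ^ α < 1

/-- The stable holonomy `H^s_{x,y} = lim_{n → ∞} A^n(y)⁻¹ A^n(x)`, for `y` in the stable set
of `x`. -/
def stableHolonomy (A : Subshift T → GLd d) (x y : Subshift T) : Euc d →L[ℝ] Euc d :=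
  limUnder atTop (fun n : ℕ => ((iter A n y)⁻¹ * iter A n x).toOp)

/-- The unstable holonomy `H^u_{x,y} = lim_{n → -∞} A^n(y)⁻¹ A^n(x)`, for `y` in the unstable
set of `x`. -/
def unstableHolonomy (A : Subshift T → GLd d) (x y : Subshift T) : Euc d →L[ℝ] Euc d :=
  limUnder atTop (fun n : ℕ => ((iterNeg A n y)⁻¹ * iterNeg A n x).toOp)

/-- The holonomy loop `ψ_z = H^s_{z,p} ∘ H^u_{p,z}` of a homoclinic point `z` of `p`. -/
def holonomyLoop (A : Subshift T → GLd d) (p z : Subshift T) : Euc d →L[ℝ] Euc d :=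
  (stableHolonomy A z p).comp (unstableHolonomy A p z)

/-- `v 0, …, v (d - 1)` are eigenvectors of `P` whose eigenvalues have pairwise distinct moduli.
Such a family is a basis of `ℝ^d` and its `d` eigenvalues are all the eigenvalues of `P` (also
over `ℂ`), each of them simple. -/
def IsPinchingEigenbasis (P : GLd d) (v : Fin d → Euc d) : Prop :=
  ∃ l : Fin d → ℝ, Function.Injective (fun i => |l i|) ∧ ∀ i, v i ≠ 0 ∧ P (v i) = l i • v i

/-- `(p, z)` is a typical pair of `A`: `p` is periodic, `z` is a homoclinic point of `p`,
`P = A^{per(p)}(p)` has simple eigenvalues of distinct moduli (pinching), and for the eigenvectors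
`v i` of `P` and all index sets `I`, `J` with `|I| + |J| ≤ d`, the vectors `ψ_z (v i)`, `i ∈ I`,
together with the vectors `v j`, `j ∈ J`, are linearly independent (twisting). -/
def IsTypicalPair (A : Subshift T → GLd d) (p z : Subshift T) : Prop :=
  p ∈ Function.periodicPts (shift (T := T)) ∧ z ∈ homoclinicPoints p ∧
    ∃ v : Fin d → Euc d,
      IsPinchingEigenbasis (iter A (Function.minimalPeriod (shift (T := T)) p) p) v ∧
      ∀ I J : Finset (Fin d), I.card + J.card ≤ d →
        LinearIndependent ℝ
          (Sum.elim (fun i : I => holonomyLoop A p z (v i)) (fun j : J => v j))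

/-- 1-typical cocycles. -/
def IsOneTypical (A : Subshift T → GLd d) : Prop :=
  IsFiberBunched A ∧ ∃ p z, IsTypicalPair A p z

end Cocycles

/-! ### Projective space and proximal maps -/

section Proximal

variable {d : ℕ}

/-- The projective space `ℙ^{d-1}` of lines in `ℝ^d`. -/
abbrev Proj (d : ℕ) : Type := Projectivization ℝ (Euc d)

/-- The angular metric `ρ(u, v) = min (∠(u, v), ∠(u, -v))`. -/
def rho (u v : Proj d) : ℝ :=
  min (InnerProductGeometry.angle u.rep v.rep) (InnerProductGeometry.angle u.rep (-v.rep))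

/-- The distance `ρ(v, S)` from a point to a set; it is `∞` for `S = ∅`. -/
def rhoSet (v : Proj d) (S : Set (Proj d)) : ENNReal :=
  ⨅ w ∈ S, ENNReal.ofReal (rho v w)

/-- The closed `δ`-neighborhood `C(S, δ)` of `S`. -/
def cone (S : Set (Proj d)) (δ : ℝ) : Set (Proj d) :=
  {v | rhoSet v S ≤ ENNReal.ofReal δ}

/-- The action of `g ∈ GL_d(ℝ)` on projective space. -/
def projAct (g : GLd d) : Proj d → Proj d :=
  Projectivization.map (g.toOp : Euc d →ₗ[ℝ] Euc d) g.injective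

/-- The Lipschitz seminorm on `K` of the projective action of `g`. -/
def rhoNormOn (g : GLd d) (K : Set (Proj d)) : ENNReal :=
  ⨆ u ∈ K, ⨆ v ∈ K, ⨆ _ : u ≠ v, ENNReal.ofReal (rho (projAct g u) (projAct g v) / rho u v)

/-- The set of points of projective space that lie in a linear subspace. -/
def projSubspace (W : Submodule ℝ (Euc d)) : Set (Proj d) :=
  {v | v.submodule ≤ W}

/-- The complex number `μ` is an eigenvalue of `g` of algebraic multiplicity one, and every other
complex eigenvalue of `g` has smaller modulus. -/
def IsDominantEigenvalue (g : GLd d) (μ : ℂ) : Prop :=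
  let χ : Polynomial ℂ := (g.toOp : Euc d →ₗ[ℝ] Euc d).charpoly.map (algebraMap ℝ ℂ)
  χ.rootMultiplicity μ = 1 ∧ ∀ ν : ℂ, χ.IsRoot ν → ν ≠ μ → ‖ν‖ < ‖μ‖

/-- `g` is proximal. -/
def IsProximal (g : GLd d) : Prop :=
  ∃ μ : ℂ, IsDominantEigenvalue g μ

/-- `g` is `ε`-proximal. The dominant eigenvalue `μ` of a proximal map is unique, hence equal to
its complex conjugate, hence real. The line `v` is its eigenline and `W` is the `g`-invariant
hyperplane complementary to `v`; both are determined by `g`. -/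
def IsEpsProximal (ε : ℝ) (g : GLd d) : Prop :=
  IsProximal g ∧
  ∃ (μ : ℝ) (v : Proj d) (W : Submodule ℝ (Euc d)),
    IsDominantEigenvalue g (μ : ℂ) ∧
    v.submodule ≤ Module.End.eigenspace (g.toOp : Euc d →ₗ[ℝ] Euc d) μ ∧
    IsCompl v.submodule W ∧ W.map (g.toOp : Euc d →ₗ[ℝ] Euc d) ≤ W ∧
    ENNReal.ofReal (2 * ε) ≤ rhoSet v (projSubspace W) ∧
    projAct g '' (cone (projSubspace W) ε)ᶜ ⊆ cone {v} ε ∧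
    rhoNormOn g (cone (projSubspace W) ε)ᶜ ≤ ENNReal.ofReal ε

end Proximal

end ProximalCocycle

end

open ProximalCocycle

noncomputable section

namespace ProximalCocycle

open Filter Topology

/-! ### Coordinates, metric and compactness of the subshift; uniform bunching. -/

section Base

variable {N : ℕ} {T : Matrix (Fin N) (Fin N) ℕ} {d : ℕ}

/-! The periodic orbit stays near `p` for a long time, makes the homoclinic loop `z`, leaves `p` to
run through the word of `x`, returns to `p`, makes the loop again and closes up near `p`. Up to
small multiplicative errors, the product along it is `P^m ψ P^l' G P^l ψ P^m`, where `G` is the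
product along the excursion through the word, padded by powers of `P`.

By pinching, `P^m`, normalized, converges to a rank-one projection `Q = φ ⊗ u`, so the product is
close to `f Q` with `f = φ (ψ P^l' G P^l ψ u)`, up to an error that is a small multiple of `‖G‖`. It
remains to keep `|f|` above a fixed multiple of `‖G‖`. By twisting, all coordinates of `ψ u` and all
coefficients of `φ ∘ ψ` are nonzero, so a Vandermonde argument shows that the `d²` numbers obtained
for `l, l' < d` determine `G`; the largest of them is at least `c ‖G‖`, with `c` independent of `G`
(`exists_dominant_pairing`, `exists_near_projection`).

Fiber-bunching controls the errors independently of the length of the word. Products along two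
orbits that shadow each other differ by factors `1 + E` at the two ends, with `E` exponentially
small in the margin of shadowing (`UniformlyBunched.distortion`). Such factors can be carried
through a power of `P` and stay small (`absorb_right`, `absorb_left`), so they are collected where
they meet only bounded operators or `G` itself.

Finally, a map with a multiple close to `Q` is `τ`-proximal (`exists_isEpsProximal_of_near`), where
`τ₀` depends only on `Q`. The closeness, the number `s` of padding periods and the exponent `m` are
fixed by `τ` before `x` and `n` are given, and `l, l' < d`; hence the excess length is bounded by
some `k(τ)`. -/

@[simp] lemma shift_apply (x : Subshift T) (i : ℤ) : (shift x).1 i = x.1 (i + 1) := rfl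

@[simp] lemma shift_pow_apply (x : Subshift T) (n : ℕ) (i : ℤ) :
    ((shift ^ n) x).1 i = x.1 (i + n) := by
  induction n generalizing i with
  | zero => simp
  | succ n ih =>
    rw [pow_succ', Equiv.Perm.mul_apply, shift_apply, ih]
    push_cast; ring_nf

@[simp] lemma shift_neg_pow_apply (x : Subshift T) (n : ℕ) (i : ℤ) :
    ((shift ^ (-(n : ℤ))) x).1 i = x.1 (i - n) := by
  have h := shift_pow_apply ((shift ^ (-(n : ℤ))) x) n (i - n)
  rw [← Equiv.Perm.mul_apply, ← zpow_natCast, ← zpow_add] at h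
  simp at h
  simp [h]

lemma shift_zpow_add (x : Subshift T) (a b : ℤ) :
    (shift ^ a) ((shift ^ b) x) = (shift ^ (a + b)) x := by
  rw [zpow_add, Equiv.Perm.mul_apply]

/-- The coordinates of `x` and `y` agree on `(-k, k)`. -/
def AgreeBall (k : ℕ) (x y : Subshift T) : Prop := ∀ j : ℤ, j.natAbs < k → x.1 j = y.1 j

lemma subshiftDist_nonneg (x y : Subshift T) : 0 ≤ subshiftDist x y := by
  unfold subshiftDist; split_ifs <;> positivity

lemma subshiftDist_le {k : ℕ} {x y : Subshift T} (h : AgreeBall k x y) :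
    subshiftDist x y ≤ (1 / 2 : ℝ) ^ k := by
  unfold subshiftDist
  split_ifs with hxy
  · positivity
  · refine pow_le_pow_of_le_one (by norm_num) (by norm_num) ?_
    refine le_csInf ?_ ?_
    · by_contra hne
      rw [Set.not_nonempty_iff_eq_empty, Set.eq_empty_iff_forall_notMem] at hne
      refine hxy (Subtype.ext (funext fun i => ?_))
      by_contra hi
      exact hne i.natAbs ⟨i, rfl, hi⟩
    · rintro b ⟨i, rfl, hi⟩
      by_contra hlt
      exact hi (h i (not_le.1 hlt))

/-- `A` is bunched at rate `η` relative to the contraction `ρ`, with constant `C`. -/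
structure UniformlyBunched (A : Subshift T → GLd d) (ρ η C : ℝ) : Prop where
  rho_pos : 0 < ρ
  rho_lt_one : ρ < 1
  eta_pos : 0 < η
  eta_lt_one : η < 1
  const_pos : 0 < C
  holder : ∀ (k : ℕ) (x y : Subshift T), AgreeBall k x y → ‖(A x).toOp - (A y).toOp‖ ≤ C * ρ ^ k
  norm_le : ∀ x, ‖(A x).toOp‖ ≤ C
  norm_inv_le : ∀ x, ‖((A x)⁻¹).toOp‖ ≤ C
  bunched : ∀ x, ‖(A x).toOp‖ * ‖((A x)⁻¹).toOp‖ * ρ ≤ η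

lemma isClosed_subshift : IsClosed {x : ℤ → Fin N | ∀ i, T (x i) (x (i + 1)) = 1} := by
  simp only [Set.ofPred_forall]
  refine isClosed_iInter fun i => ?_
  have : Continuous fun x : ℤ → Fin N => (x i, x (i + 1)) := by fun_prop
  exact (isClosed_discrete {q : Fin N × Fin N | T q.1 q.2 = 1}).preimage this

instance : CompactSpace (Subshift T) :=
  isCompact_iff_compactSpace.1 (isClosed_subshift (T := T)).isCompact

lemma eventually_agreeBall (k : ℕ) (x : Subshift T) : ∀ᶠ y in 𝓝 x, AgreeBall k x y := by
  have h : ∀ᶠ y in 𝓝 x, ∀ j ∈ Finset.Ioo (-(k : ℤ)) k, x.1 j = y.1 j := by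
    rw [Filter.eventually_all_finset]
    intro j _
    have hc : Continuous fun y : Subshift T => y.1 j :=
      (continuous_apply j).comp continuous_subtype_val
    have := hc.continuousAt (x := x) (isOpen_discrete {x.1 j} |>.mem_nhds rfl)
    filter_upwards [this] with y hy using (by simpa using hy : y.1 j = x.1 j).symm
  filter_upwards [h] with y hy j hj
  exact hy j (by rw [Finset.mem_Ioo]; omega)

/-- The Hölder bound makes `A` and its inverse continuous, so by compactness the pointwise strict
bunching inequality has a uniform gap. The contraction rate is `ρ = (1/2)^α`. -/
lemma IsFiberBunched.uniformlyBunched [Nonempty (Subshift T)] {A : Subshift T → GLd d}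
    (hA : IsFiberBunched A) : ∃ ρ η C : ℝ, UniformlyBunched A ρ η C := by
  obtain ⟨α, hα, -, ⟨C, hC⟩, hb⟩ := hA
  set ρ : ℝ := (1 / 2 : ℝ) ^ α with hρ
  have hρ0 : 0 < ρ := by positivity
  have hρ1 : ρ < 1 := Real.rpow_lt_one (by norm_num) (by norm_num) hα
  have hold : ∀ (k : ℕ) (x y : Subshift T), AgreeBall k x y →
      ‖(A x).toOp - (A y).toOp‖ ≤ |C| * ρ ^ k := by
    intro k x y h
    refine (hC x y).trans ?_
    have h1 : subshiftDist x y ^ α ≤ ρ ^ k := by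
      calc subshiftDist x y ^ α ≤ ((1 / 2 : ℝ) ^ k) ^ α :=
            Real.rpow_le_rpow (subshiftDist_nonneg x y) (subshiftDist_le h) hα.le
        _ = ρ ^ k := by
            rw [hρ, ← Real.rpow_natCast, ← Real.rpow_natCast, ← Real.rpow_mul (by norm_num),
              ← Real.rpow_mul (by norm_num), mul_comm]
    have h0 : 0 ≤ subshiftDist x y ^ α := Real.rpow_nonneg (subshiftDist_nonneg x y) _
    exact (mul_le_mul_of_nonneg_right (le_abs_self C) h0).trans
      (mul_le_mul_of_nonneg_left h1 (abs_nonneg C))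
  have hcont : Continuous fun x => (A x).toOp := by
    rw [continuous_iff_continuousAt]
    intro x
    rw [ContinuousAt, Metric.tendsto_nhds]
    intro ε hε
    have ht : Tendsto (fun k : ℕ => |C| * ρ ^ k) atTop (𝓝 0) := by
      simpa using (tendsto_pow_atTop_nhds_zero_of_lt_one hρ0.le hρ1).const_mul |C|
    obtain ⟨k, hk⟩ := (ht.eventually (gt_mem_nhds hε)).exists
    filter_upwards [eventually_agreeBall k x] with y hy
    rw [dist_comm, dist_eq_norm]
    exact (hold k x y hy).trans_lt hk
  have hcont' : Continuous fun x => ((A x)⁻¹).toOp := by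
    have h : (fun x => ((A x)⁻¹).toOp) = fun x => Ring.inverse (A x).toOp := by
      funext x
      rw [ContinuousLinearMap.ringInverse_equiv, ContinuousLinearMap.inverse_equiv]
      rfl
    rw [h, continuous_iff_continuousAt]
    intro x
    exact ContinuousAt.comp (f := fun x => (A x).toOp)
      (NormedRing.inverse_continuousAt (ContinuousLinearEquiv.toUnit (A x))) hcont.continuousAt
  obtain ⟨x1, -, h1⟩ := isCompact_univ.exists_isMaxOn Set.univ_nonempty
    (hcont.norm.continuousOn (s := Set.univ))
  obtain ⟨x2, -, h2⟩ := isCompact_univ.exists_isMaxOn Set.univ_nonempty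
    (hcont'.norm.continuousOn (s := Set.univ))
  obtain ⟨x3, -, h3⟩ := isCompact_univ.exists_isMaxOn Set.univ_nonempty
    (((hcont.norm.mul hcont'.norm).mul_const ρ).continuousOn (s := Set.univ))
  rw [isMaxOn_univ_iff] at h1 h2 h3
  -- The maximum with `1 / 2` only serves to keep the rate positive, also when `d = 0`.
  refine ⟨ρ, max (1 / 2) (‖(A x3).toOp‖ * ‖((A x3)⁻¹).toOp‖ * ρ),
    |C| + ‖(A x1).toOp‖ + ‖((A x2)⁻¹).toOp‖ + 1, hρ0, hρ1, ?_, ?_, by positivity, ?_, ?_, ?_, ?_⟩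
  · exact lt_max_of_lt_left (by norm_num)
  · exact max_lt (by norm_num) (hb x3)
  · intro k x y h
    refine (hold k x y h).trans (mul_le_mul_of_nonneg_right ?_ (by positivity))
    linarith [norm_nonneg (A x1).toOp, norm_nonneg ((A x2)⁻¹).toOp]
  · intro x
    have := h1 x
    linarith [norm_nonneg ((A x2)⁻¹).toOp, abs_nonneg C]
  · intro x
    have := h2 x
    linarith [norm_nonneg (A x1).toOp, abs_nonneg C]
  · exact fun x => (h3 x).trans (le_max_right _ _)

end Base

/-! ### Distortion estimates -/

/-- Discrete Gronwall: each step multiplies the norm by at most `1 + c η^h ≤ exp (c η^h)`, and the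
exponents form a convergent geometric series. -/
lemma norm_growth_le {E : Type*} [NormedAddCommGroup E] {F : ℕ → E} {c η : ℝ} (hc : 0 ≤ c)
    (hη0 : 0 < η) (hη1 : η < 1) {n : ℕ}
    (hF : ∀ h < n, ‖F (h + 1) - F h‖ ≤ c * η ^ h * ‖F h‖) :
    ‖F n‖ ≤ Real.exp (c / (1 - η)) * ‖F 0‖ ∧
      ‖F n - F 0‖ ≤ c / (1 - η) * Real.exp (c / (1 - η)) * ‖F 0‖ := by
  have hS : ∀ m, ∑ i ∈ Finset.range m, η ^ i ≤ 1 / (1 - η) := by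
    intro m
    rw [one_div, ← tsum_geometric_of_lt_one hη0.le hη1]
    exact (summable_geometric_of_lt_one hη0.le hη1).sum_le_tsum _ (fun i _ => by positivity)
  have hcS : ∀ m, c * ∑ i ∈ Finset.range m, η ^ i ≤ c / (1 - η) := by
    intro m
    calc c * ∑ i ∈ Finset.range m, η ^ i ≤ c * (1 / (1 - η)) := mul_le_mul_of_nonneg_left (hS m) hc
      _ = c / (1 - η) := by ring
  have key : ∀ m ≤ n, ‖F m‖ ≤ Real.exp (c * ∑ i ∈ Finset.range m, η ^ i) * ‖F 0‖ ∧
      ‖F m - F 0‖ ≤ c * (∑ i ∈ Finset.range m, η ^ i) * (Real.exp (c / (1 - η)) * ‖F 0‖) := by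
    intro m
    induction m with
    | zero => intro _; simp
    | succ m ih =>
      intro hm
      obtain ⟨h1, h2⟩ := ih (by omega)
      have hs := hF m (by omega)
      rw [Finset.sum_range_succ, mul_add, Real.exp_add]
      have hx : 0 ≤ c * η ^ m := by positivity
      constructor
      · have : ‖F (m + 1)‖ ≤ ‖F (m + 1) - F m‖ + ‖F m‖ := by
          simpa using norm_add_le (F (m + 1) - F m) (F m)
        calc ‖F (m + 1)‖ ≤ (c * η ^ m + 1) * ‖F m‖ := by linarith
          _ ≤ Real.exp (c * η ^ m) * (Real.exp (c * ∑ i ∈ Finset.range m, η ^ i) * ‖F 0‖) :=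
            mul_le_mul (Real.add_one_le_exp _) h1 (norm_nonneg _) (Real.exp_pos _).le
          _ = _ := by ring
      · have h3 : ‖F m‖ ≤ Real.exp (c / (1 - η)) * ‖F 0‖ :=
          h1.trans (mul_le_mul_of_nonneg_right (Real.exp_le_exp.2 (hcS m)) (norm_nonneg _))
        have : ‖F (m + 1) - F 0‖ ≤ ‖F (m + 1) - F m‖ + ‖F m - F 0‖ := by
          simpa using norm_add_le (F (m + 1) - F m) (F m - F 0)
        have h4 : c * η ^ m * ‖F m‖ ≤ c * η ^ m * (Real.exp (c / (1 - η)) * ‖F 0‖) :=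
          mul_le_mul_of_nonneg_left h3 hx
        rw [add_mul]
        linarith
  obtain ⟨h1, h2⟩ := key n le_rfl
  refine ⟨h1.trans (mul_le_mul_of_nonneg_right (Real.exp_le_exp.2 (hcS n)) (norm_nonneg _)), ?_⟩
  rw [mul_assoc]
  exact h2.trans (mul_le_mul_of_nonneg_right (hcS n) (by positivity))

lemma exists_tendsto_of_growth {E : Type*} [NormedAddCommGroup E] [CompleteSpace E] {F : ℕ → E}
    {c η : ℝ} (hc : 0 ≤ c) (hη0 : 0 < η) (hη1 : η < 1)
    (hF : ∀ h, ‖F (h + 1) - F h‖ ≤ c * η ^ h * ‖F h‖) : ∃ a, Tendsto F atTop (𝓝 a) := by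
  refine cauchySeq_tendsto_of_complete
    (cauchySeq_of_le_geometric η (c * (Real.exp (c / (1 - η)) * ‖F 0‖)) hη1 fun n => ?_)
  rw [dist_comm, dist_eq_norm]
  have h1 := (norm_growth_le hc hη0 hη1 (n := n) (F := F) fun h _ => hF h).1
  calc ‖F (n + 1) - F n‖ ≤ c * η ^ n * ‖F n‖ := hF n
    _ ≤ c * η ^ n * (Real.exp (c / (1 - η)) * ‖F 0‖) :=
      mul_le_mul_of_nonneg_left h1 (by positivity)
    _ = _ := by ring

/-! ### Iterates, shadowing estimates and holonomies of bunched cocycles. -/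

section Cocycle

variable {N : ℕ} {T : Matrix (Fin N) (Fin N) ℕ} {d : ℕ}

lemma toOp_mul (g h : GLd d) : (g * h).toOp = g.toOp * h.toOp := rfl

lemma toOp_one : (1 : GLd d).toOp = 1 := rfl

lemma toOp_mul_inv (g : GLd d) : g.toOp * (g⁻¹).toOp = 1 := by
  rw [← toOp_mul, mul_inv_cancel, toOp_one]

lemma toOp_inv_mul (g : GLd d) : (g⁻¹).toOp * g.toOp = 1 := by
  rw [← toOp_mul, inv_mul_cancel, toOp_one]

lemma toOp_pow (g : GLd d) (n : ℕ) : (g ^ n).toOp = g.toOp ^ n := by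
  induction n with
  | zero => rfl
  | succ n ih => rw [pow_succ, pow_succ, toOp_mul, ih]

lemma norm_one_le : ‖(1 : Euc d →L[ℝ] Euc d)‖ ≤ 1 := ContinuousLinearMap.norm_id_le

lemma forward_identity {R : Type*} [Ring R] {X X' a a' b Y : R} (h1 : X * X' = 1)
    (h2 : a' * a = 1) : X' * a' * (b * Y) - X' * Y = X' * (a' * (b - a)) * X * (X' * Y) := by
  rw [mul_sub, h2, mul_assoc _ X, ← mul_assoc X, h1]
  noncomm_ring

lemma backward_identity {R : Type*} [Ring R] {X X' a a' b Y : R} (h1 : X' * X = 1)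
    (h2 : a * a' = 1) : Y * b * (a' * X') - Y * X' = Y * X' * (X * ((b - a) * a') * X') := by
  have h : Y * X' * (X * (b * a' - 1) * X') = Y * (X' * X) * (b * a' - 1) * X' := by noncomm_ring
  rw [sub_mul, h2, h, h1]
  noncomm_ring

lemma iter_add (A : Subshift T → GLd d) (m n : ℕ) (x : Subshift T) :
    iter A (m + n) x = iter A m ((shift ^ n) x) * iter A n x := by
  induction m with
  | zero => simp [iter]
  | succ m ih =>
    rw [show m + 1 + n = (m + n) + 1 by ring, iter, iter, ih, pow_add, Equiv.Perm.mul_apply,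
      mul_assoc]

lemma iter_one (A : Subshift T → GLd d) (x : Subshift T) : iter A 1 x = A x := by
  simp [iter]

lemma iter_periodic (A : Subshift T → GLd d) {π : ℕ} {p : Subshift T}
    (hp : (shift ^ π) p = p) (m : ℕ) : iter A (m * π) p = iter A π p ^ m := by
  induction m with
  | zero => simp [iter]
  | succ m ih =>
    have : (shift ^ (m * π)) p = p := by
      clear ih
      induction m with
      | zero => simp
      | succ m ih => rw [Nat.succ_mul, pow_add, Equiv.Perm.mul_apply, hp, ih]
    rw [Nat.succ_mul, add_comm, iter_add, this, ih, pow_succ']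

namespace UniformlyBunched

variable {A : Subshift T → GLd d} {ρ η C : ℝ} (hA : UniformlyBunched A ρ η C)
include hA

lemma norm_iter_mul_norm_inv_le (n : ℕ) (x : Subshift T) :
    ‖(iter A n x).toOp‖ * ‖((iter A n x)⁻¹).toOp‖ * ρ ^ n ≤ η ^ n := by
  induction n with
  | zero =>
    simp only [iter, inv_one, toOp_one, pow_zero, mul_one]
    exact mul_le_one₀ norm_one_le (norm_nonneg _) norm_one_le
  | succ n ih =>
    rw [iter, mul_inv_rev, toOp_mul, toOp_mul, pow_succ, pow_succ]
    have h1 := norm_mul_le (A ((shift ^ n) x)).toOp (iter A n x).toOp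
    have h2 := norm_mul_le ((iter A n x)⁻¹).toOp ((A ((shift ^ n) x))⁻¹).toOp
    have hρ := hA.rho_pos
    calc _ ≤ (‖(A ((shift ^ n) x)).toOp‖ * ‖(iter A n x).toOp‖) *
          (‖((iter A n x)⁻¹).toOp‖ * ‖((A ((shift ^ n) x))⁻¹).toOp‖) * (ρ ^ n * ρ) := by gcongr
      _ = (‖(iter A n x).toOp‖ * ‖((iter A n x)⁻¹).toOp‖ * ρ ^ n) *
          (‖(A ((shift ^ n) x)).toOp‖ * ‖((A ((shift ^ n) x))⁻¹).toOp‖ * ρ) := by ring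
      _ ≤ η ^ n * η := by
        have := hA.eta_pos
        have := hA.bunched ((shift ^ n) x)
        gcongr

/-- Conjugating by a product of length `n` a perturbation of size `κ * ρ ^ n` scales it by
`η ^ n`. -/
lemma norm_conj_le {n : ℕ} {x : Subshift T} {e : Euc d →L[ℝ] Euc d} {κ : ℝ} (hκ : 0 ≤ κ)
    (he : ‖e‖ ≤ κ * ρ ^ n) :
    ‖((iter A n x)⁻¹).toOp * e * (iter A n x).toOp‖ ≤ κ * η ^ n ∧
      ‖(iter A n x).toOp * e * ((iter A n x)⁻¹).toOp‖ ≤ κ * η ^ n := by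
  have h := hA.norm_iter_mul_norm_inv_le n x
  have hb : ‖(iter A n x).toOp‖ * ‖((iter A n x)⁻¹).toOp‖ * ‖e‖ ≤ κ * η ^ n := by
    calc _ ≤ ‖(iter A n x).toOp‖ * ‖((iter A n x)⁻¹).toOp‖ * (κ * ρ ^ n) := by gcongr
      _ = κ * (‖(iter A n x).toOp‖ * ‖((iter A n x)⁻¹).toOp‖ * ρ ^ n) := by ring
      _ ≤ κ * η ^ n := by gcongr
  constructor
  · refine (norm_mul_le _ _).trans ((mul_le_mul_of_nonneg_right (norm_mul_le _ _)
      (norm_nonneg _)).trans (le_trans (le_of_eq ?_) hb)); ring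
  · refine (norm_mul_le _ _).trans ((mul_le_mul_of_nonneg_right (norm_mul_le _ _)
      (norm_nonneg _)).trans (le_trans (le_of_eq ?_) hb)); ring

/-- The quotient `X⁻¹ Y` of two products changes in one step by a conjugate `X⁻¹ e X` times itself.
The perturbation `e` is of order `ρ^h`, and bunching turns this into `η^h` after conjugation. -/
lemma forward_step {h : ℕ} {x y : Subshift T} {κ : ℝ} (hκ : 0 ≤ κ)
    (hxy : ‖(A ((shift ^ h) x)).toOp - (A ((shift ^ h) y)).toOp‖ ≤ C * (κ * ρ ^ h)) :
    ‖((iter A (h + 1) x)⁻¹ * iter A (h + 1) y).toOp - ((iter A h x)⁻¹ * iter A h y).toOp‖ ≤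
      C ^ 2 * κ * η ^ h * ‖((iter A h x)⁻¹ * iter A h y).toOp‖ := by
  set a := A ((shift ^ h) x) with ha
  set b := A ((shift ^ h) y) with hb
  set X := iter A h x with hX
  set Y := iter A h y with hY
  have hC := hA.const_pos
  have he : ‖(a⁻¹).toOp * (b.toOp - a.toOp)‖ ≤ (C ^ 2 * κ) * ρ ^ h := by
    calc _ ≤ ‖(a⁻¹).toOp‖ * ‖b.toOp - a.toOp‖ := norm_mul_le _ _
      _ ≤ C * (C * (κ * ρ ^ h)) := by
        rw [norm_sub_rev]
        exact mul_le_mul (hA.norm_inv_le _) hxy (norm_nonneg _) hC.le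
      _ = _ := by ring
  have hc := (hA.norm_conj_le (x := x) (by positivity) he).1
  have heq : ((iter A (h + 1) x)⁻¹ * iter A (h + 1) y).toOp - (X⁻¹ * Y).toOp =
      ((X⁻¹).toOp * ((a⁻¹).toOp * (b.toOp - a.toOp)) * X.toOp) * (X⁻¹ * Y).toOp := by
    rw [iter, iter, mul_inv_rev]
    simp only [toOp_mul]
    exact forward_identity (toOp_mul_inv X) (toOp_inv_mul a)
  rw [heq]
  exact (norm_mul_le _ _).trans (mul_le_mul_of_nonneg_right hc (norm_nonneg _))

/-- Mirror image of `forward_step`: the final time is fixed, the initial time moves back by one, and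
the quotient is `Y X⁻¹`. -/
lemma backward_step {h : ℕ} {x y : Subshift T} {κ : ℝ} (hκ : 0 ≤ κ)
    (hxy : ‖(A x).toOp - (A y).toOp‖ ≤ C * (κ * ρ ^ h)) :
    ‖(iter A (h + 1) y * (iter A (h + 1) x)⁻¹).toOp -
        (iter A h (shift y) * (iter A h (shift x))⁻¹).toOp‖ ≤
      C ^ 2 * κ * η ^ h * ‖(iter A h (shift y) * (iter A h (shift x))⁻¹).toOp‖ := by
  set a := A x with ha
  set b := A y with hb
  set X := iter A h (shift x) with hX
  set Y := iter A h (shift y) with hY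
  have hC := hA.const_pos
  have he : ‖(b.toOp - a.toOp) * (a⁻¹).toOp‖ ≤ (C ^ 2 * κ) * ρ ^ h := by
    calc _ ≤ ‖b.toOp - a.toOp‖ * ‖(a⁻¹).toOp‖ := norm_mul_le _ _
      _ ≤ (C * (κ * ρ ^ h)) * C := by
        rw [norm_sub_rev]
        exact mul_le_mul hxy (hA.norm_inv_le _) (norm_nonneg _) ((norm_nonneg _).trans hxy)
      _ = _ := by ring
  have hc := (hA.norm_conj_le (x := shift x) (by positivity) he).2
  have heq : (iter A (h + 1) y * (iter A (h + 1) x)⁻¹).toOp - (Y * X⁻¹).toOp =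
      (Y * X⁻¹).toOp * (X.toOp * ((b.toOp - a.toOp) * (a⁻¹).toOp) * (X⁻¹).toOp) := by
    rw [iter_add, iter_add, iter_one, iter_one, pow_one, mul_inv_rev]
    simp only [toOp_mul]
    exact backward_identity (toOp_inv_mul X) (toOp_mul_inv a)
  rw [heq]
  refine (norm_mul_le _ _).trans ?_
  rw [mul_comm (C ^ 2 * κ * η ^ h)]
  exact mul_le_mul_of_nonneg_left hc (norm_nonneg _)

end UniformlyBunched

/-- The constant of the distortion estimate. -/
def distConst (η C : ℝ) : ℝ := C ^ 2 / (1 - η) * Real.exp (C ^ 2 / (1 - η))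

lemma UniformlyBunched.distConst_nonneg {A : Subshift T → GLd d} {ρ η C : ℝ}
    (hA : UniformlyBunched A ρ η C) : 0 ≤ distConst η C := by
  have := hA.eta_lt_one
  unfold distConst
  have : 0 ≤ 1 - η := by linarith
  positivity

lemma UniformlyBunched.growth_le_distConst {A : Subshift T → GLd d} {ρ η C : ℝ}
    (hA : UniformlyBunched A ρ η C) {κ : ℝ} (hκ0 : 0 ≤ κ) (hκ1 : κ ≤ 1) {f : ℝ}
    (hf0 : 0 ≤ f) (hf : f ≤ 1) :
    C ^ 2 * κ / (1 - η) * Real.exp (C ^ 2 * κ / (1 - η)) * f ≤ distConst η C * κ := by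
  have := hA.eta_lt_one
  have h1 : 0 < 1 - η := by linarith
  have h2 : C ^ 2 * κ / (1 - η) ≤ C ^ 2 / (1 - η) := by
    gcongr
    exact mul_le_of_le_one_right (by positivity) hκ1
  calc _ ≤ C ^ 2 * κ / (1 - η) * Real.exp (C ^ 2 / (1 - η)) * 1 := by gcongr
    _ = _ := by unfold distConst; ring

/-- Along an orbit segment shadowed with margins `a` and `b`, two products differ by factors close
to the identity at the ends. -/
lemma UniformlyBunched.distortion {A : Subshift T → GLd d} {ρ η C : ℝ}
    (hA : UniformlyBunched A ρ η C) {a b n : ℕ} (ha : a ≤ n + b) (hb : b ≤ n + a)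
    {x y : Subshift T} (hxy : ∀ i : ℤ, -a ≤ i → i ≤ n + b → x.1 i = y.1 i) :
    ∃ E E' : Euc d →L[ℝ] Euc d, ‖E‖ ≤ distConst η C * ρ ^ a ∧ ‖E'‖ ≤ distConst η C * ρ ^ b ∧
      (iter A n y).toOp = (1 + E') * (iter A n x).toOp * (1 + E) := by
  have hρ0 := hA.rho_pos
  have hρ1 := hA.rho_lt_one
  -- The time `h` is the midpoint of `[-a, n + b]`. Before it the radius of agreement at time `i` is
  -- at least `a + i`, which suits forward comparison; after it the radius is governed by the right
  -- end, which suits backward comparison.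
  obtain ⟨h, hh⟩ : ∃ h, h = (n + b - a) / 2 := ⟨_, rfl⟩
  have hhn : h ≤ n := by omega
  have hF := (norm_growth_le (F := fun i => ((iter A i x)⁻¹ * iter A i y).toOp) (n := h)
    (c := C ^ 2 * ρ ^ a) (by positivity) hA.eta_pos hA.eta_lt_one (fun i hi => by
      refine hA.forward_step (by positivity) ?_
      rw [← pow_add]
      refine hA.holder _ _ _ fun j hj => ?_
      rw [shift_pow_apply, shift_pow_apply]
      exact hxy _ (by omega) (by omega))).2
  have hB := (norm_growth_le (F := fun i => (iter A i ((shift ^ (n - i)) y) *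
      (iter A i ((shift ^ (n - i)) x))⁻¹).toOp) (n := n - h)
    (c := C ^ 2 * ρ ^ b) (by positivity) hA.eta_pos hA.eta_lt_one (fun i hi => by
      have hs : n - i = (n - (i + 1)) + 1 := by omega
      simp only [hs, pow_succ' shift, Equiv.Perm.mul_apply]
      refine hA.backward_step (by positivity) ?_
      rw [← pow_add]
      refine hA.holder _ _ _ fun j hj => ?_
      rw [shift_pow_apply, shift_pow_apply]
      exact hxy _ (by omega) (by omega))).2
  simp only [iter, inv_one, mul_one, toOp_one] at hF hB
  refine ⟨_, _, hF.trans (hA.growth_le_distConst (by positivity) (pow_le_one₀ hρ0.le hρ1.le)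
    (norm_nonneg _) norm_one_le), hB.trans (hA.growth_le_distConst (by positivity)
    (pow_le_one₀ hρ0.le hρ1.le) (norm_nonneg _) norm_one_le), ?_⟩
  rw [add_sub_cancel, add_sub_cancel, ← toOp_mul, ← toOp_mul]
  congr 1
  have e : ∀ w, iter A n w = iter A (n - h) ((shift ^ h) w) * iter A h w := by
    intro w; rw [← iter_add]; congr 1; omega
  rw [show n - (n - h) = h by omega, e x, e y]
  group

lemma UniformlyBunched.rho_pow_sub_le {A : Subshift T → GLd d} {ρ η C : ℝ}
    (hA : UniformlyBunched A ρ η C) (n r : ℕ) : ρ ^ (n - r) ≤ (ρ ^ r)⁻¹ * ρ ^ n := by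
  have hρ0 := hA.rho_pos
  rw [inv_mul_eq_div, le_div_iff₀ (by positivity), ← pow_add]
  exact pow_le_pow_of_le_one hρ0.le hA.rho_lt_one.le (by omega)

/-- Since the holonomy is defined by `limUnder`, existence of the limit must be shown; it follows
from the summable relative increments of `forward_step`. Agreement from time `r` on costs a factor
`ρ^(-r)`. -/
lemma UniformlyBunched.tendsto_stableHolonomy {A : Subshift T → GLd d} {ρ η C : ℝ}
    (hA : UniformlyBunched A ρ η C) {x y : Subshift T} {r : ℕ}
    (hxy : ∀ i : ℤ, r ≤ i → x.1 i = y.1 i) :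
    Tendsto (fun n : ℕ => ((iter A n y)⁻¹ * iter A n x).toOp) atTop
      (𝓝 (stableHolonomy A x y)) := by
  have hρ0 := hA.rho_pos
  have hC := hA.const_pos
  refine tendsto_nhds_limUnder (exists_tendsto_of_growth (c := C ^ 2 * (ρ ^ r)⁻¹)
    (F := fun n : ℕ => ((iter A n y)⁻¹ * iter A n x).toOp) (by positivity)
    hA.eta_pos hA.eta_lt_one fun n => ?_)
  refine hA.forward_step (by positivity) ?_
  refine (hA.holder (n - r) _ _ fun j hj => ?_).trans
    (mul_le_mul_of_nonneg_left (hA.rho_pow_sub_le n r) hC.le)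
  rw [shift_pow_apply, shift_pow_apply]
  exact (hxy _ (by omega)).symm

lemma UniformlyBunched.tendsto_unstableHolonomy {A : Subshift T → GLd d} {ρ η C : ℝ}
    (hA : UniformlyBunched A ρ η C) {x y : Subshift T} {r : ℕ}
    (hxy : ∀ i : ℤ, i ≤ -r → x.1 i = y.1 i) :
    Tendsto (fun n : ℕ => (iter A n ((shift ^ (-(n : ℤ))) y) *
      (iter A n ((shift ^ (-(n : ℤ))) x))⁻¹).toOp) atTop (𝓝 (unstableHolonomy A x y)) := by
  have hρ0 := hA.rho_pos
  have hC := hA.const_pos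
  have he : (fun n : ℕ => ((iterNeg A n y)⁻¹ * iterNeg A n x).toOp) = fun n : ℕ =>
      (iter A n ((shift ^ (-(n : ℤ))) y) * (iter A n ((shift ^ (-(n : ℤ))) x))⁻¹).toOp := by
    funext n; rw [iterNeg, iterNeg, inv_inv]
  rw [← he]
  exact tendsto_nhds_limUnder (exists_tendsto_of_growth (c := C ^ 2 * (ρ ^ r)⁻¹)
    (F := fun n : ℕ => ((iterNeg A n y)⁻¹ * iterNeg A n x).toOp) (by positivity)
    hA.eta_pos hA.eta_lt_one fun n => by
      simp only [congrFun he]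
      have hs : ∀ w : Subshift T, (shift ^ (-(n : ℤ))) w =
          shift ((shift ^ (-((n + 1 : ℕ) : ℤ))) w) := by
        intro w
        ext i
        rw [shift_neg_pow_apply, shift_apply, shift_neg_pow_apply]
        push_cast
        ring_nf
      rw [hs x, hs y]
      refine hA.backward_step (by positivity) ?_
      refine (hA.holder (n - r) _ _ fun j hj => ?_).trans
        (mul_le_mul_of_nonneg_left (hA.rho_pow_sub_le n r) hC.le)
      rw [shift_neg_pow_apply, shift_neg_pow_apply]
      exact hxy _ (by omega))

end Cocycle

/-! ### Gluing orbits -/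

section Gluing

variable {N : ℕ} {T : Matrix (Fin N) (Fin N) ℕ}

/-- The point that follows `x` before time `t` and `y` from time `t` on. -/
def glue (x y : Subshift T) (t : ℤ) (h : x.1 t = y.1 t) : Subshift T :=
  ⟨fun i => if i < t then x.1 i else y.1 i, fun i => by
    by_cases h1 : i + 1 < t
    · simpa [show i < t by omega, h1] using x.2 i
    · by_cases h2 : i < t
      · have ht : i + 1 = t := by omega
        simpa [h1, h2, ht, ← h] using (ht ▸ x.2 i)
      · simpa [h1, h2] using y.2 i⟩

/-- The range is extended past the cut as far as the two points agree; these overlaps supply the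
margins of the distortion estimate. -/
lemma glue_apply_left {x y : Subshift T} {t : ℤ} (h : x.1 t = y.1 t) {k i : ℤ} (hi : i ≤ k)
    (hk : ∀ j, t ≤ j → j ≤ k → x.1 j = y.1 j) : (glue x y t h).1 i = x.1 i := by
  change (if i < t then x.1 i else y.1 i) = _
  split_ifs with h1
  · rfl
  · exact (hk i (by omega) hi).symm

lemma glue_apply_right {x y : Subshift T} {t : ℤ} (h : x.1 t = y.1 t) {k i : ℤ} (hi : k ≤ i)
    (hk : ∀ j, k ≤ j → j < t → x.1 j = y.1 j) : (glue x y t h).1 i = y.1 i := by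
  change (if i < t then x.1 i else y.1 i) = _
  split_ifs with h1
  · exact hk i hi h1
  · rfl

/-- The periodic point that repeats the block `x_0 ⋯ x_{L-1}`. -/
def periodize (x : Subshift T) (L : ℕ) (hL : 0 < L) (h : x.1 0 = x.1 L) : Subshift T :=
  ⟨fun i => x.1 (i % L), fun i => by
    have h0 := Int.emod_nonneg i (b := (L : ℤ)) (by omega)
    have h1 := Int.emod_lt_of_pos i (b := (L : ℤ)) (by omega)
    have h2 : (i + 1) % L = (i % L + 1) % L := by simp
    change T (x.1 (i % L)) (x.1 ((i + 1) % L)) = 1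
    rw [h2]
    by_cases h3 : i % L + 1 < L
    · rw [Int.emod_eq_of_lt (by omega) h3]
      exact x.2 _
    · have h4 : i % L + 1 = L := by omega
      have h5 := x.2 (i % L)
      rw [h4] at h5 ⊢
      rw [Int.emod_self, h]
      exact h5⟩

lemma shift_pow_periodize (x : Subshift T) (L : ℕ) (hL : 0 < L) (h : x.1 0 = x.1 L) :
    (shift ^ L) (periodize x L hL h) = periodize x L hL h := by
  ext i
  rw [shift_pow_apply]
  change ((x.1 ((i + L) % L) : Fin N) : ℕ) = x.1 (i % L)
  simp

/-- Agreement of `x` with its own translate by `L` around `0` gives shadowing beyond both ends of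
the repeated block. -/
lemma periodize_apply {x : Subshift T} {L : ℕ} {hL : 0 < L} (h : x.1 0 = x.1 L) {k : ℤ}
    (hkL : k < L) (hk : ∀ i, -k ≤ i → i ≤ k → x.1 i = x.1 (i + L)) {i : ℤ} (hi : -k ≤ i)
    (hi' : i ≤ L + k) : (periodize x L hL h).1 i = x.1 i := by
  change x.1 (i % L) = x.1 i
  by_cases h1 : i < 0
  · rw [← Int.add_emod_right, Int.emod_eq_of_lt (by omega) (by omega)]
    exact (hk i hi (by omega)).symm
  · by_cases h2 : i < L
    · rw [Int.emod_eq_of_lt (by omega) h2]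
    · rw [← Int.sub_emod_right, Int.emod_eq_of_lt (by omega) (by omega)]
      rw [hk (i - L) (by omega) (by omega), sub_add_cancel]

lemma exists_path (hT : ∀ i j, T i j = 0 ∨ T i j = 1) (M : ℕ) (a b : Fin N)
    (h : 0 < (T ^ M) a b) :
    ∃ w : ℕ → Fin N, w 0 = a ∧ w M = b ∧ ∀ i < M, T (w i) (w (i + 1)) = 1 := by
  induction M generalizing b with
  | zero =>
    refine ⟨fun _ => a, rfl, ?_, by simp⟩
    by_contra hne
    simp [Matrix.one_apply_ne hne] at h
  | succ M ih =>
    rw [pow_succ, Matrix.mul_apply] at h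
    obtain ⟨c, -, hc⟩ := Finset.exists_ne_zero_of_sum_ne_zero h.ne'
    obtain ⟨w, hw0, hwM, hw⟩ := ih c (Nat.pos_of_ne_zero (left_ne_zero_of_mul hc))
    refine ⟨fun i => if i ≤ M then w i else b, by simp [hw0], by simp, fun i hi => ?_⟩
    by_cases h1 : i + 1 ≤ M
    · simpa [h1, show i ≤ M by omega] using hw i (by omega)
    · have : i = M := by omega
      subst this
      simpa [hwM] using (hT c b).resolve_left (right_ne_zero_of_mul hc)

/-- A transition of length `M` from the past of `x` to the future of `y`. -/
lemma exists_bridge (hT : ∀ i j, T i j = 0 ∨ T i j = 1) {M : ℕ} (hM : ∀ i j, 0 < (T ^ M) i j)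
    (x y : Subshift T) :
    ∃ w : Subshift T, (∀ i ≤ 0, w.1 i = x.1 i) ∧ ∀ i : ℤ, M ≤ i → w.1 i = y.1 (i - M) := by
  obtain ⟨w, hw0, hwM, hw⟩ := exists_path hT M (x.1 0) (y.1 0) (hM _ _)
  refine ⟨⟨fun i => if i ≤ 0 then x.1 i else if i < M then w i.toNat else y.1 (i - M),
    fun i => ?_⟩, fun i hi => by simp [hi], fun i hi => ?_⟩
  · by_cases h1 : i + 1 ≤ 0
    · simpa [h1, show i ≤ 0 by omega] using x.2 i
    by_cases h2 : i < M
    · have e1 : (if i ≤ 0 then x.1 i else if i < M then w i.toNat else y.1 (i - M)) =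
          w i.toNat := by
        split_ifs with h3
        · obtain rfl : i = 0 := by omega
          simp [hw0]
        · rfl
      have e2 : (if i + 1 < M then w (i + 1).toNat else y.1 (i + 1 - M)) = w (i.toNat + 1) := by
        split_ifs with h3
        · congr 1; omega
        · rw [show i + 1 - M = 0 by omega, ← hwM]; congr 1; omega
      simp only [h1, if_false, e1, e2]
      exact hw _ (by omega)
    · by_cases h3 : i ≤ 0
      · obtain ⟨rfl, hi⟩ : M = 0 ∧ i = 0 := by omega
        subst hi
        have e : x.1 0 = y.1 0 := by rw [← hw0, ← hwM]
        simpa [e] using y.2 0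
      · have e : i + 1 - M = i - M + 1 := by ring
        simpa [h1, h2, h3, show ¬ i + 1 < M by omega, e] using y.2 (i - M)
  · by_cases h1 : i ≤ 0
    · obtain ⟨rfl, hi0⟩ : M = 0 ∧ i = 0 := by omega
      subst hi0
      simp [← hw0, ← hwM]
    · simp [h1, show ¬ i < M by omega]

/-- A point heteroclinic from `p` to `p` through the block `x_0 ⋯ x_n`. -/
lemma exists_excursion (hT : ∀ i j, T i j = 0 ∨ T i j = 1) {M : ℕ}
    (hM : ∀ i j, 0 < (T ^ M) i j) (p x : Subshift T) (n : ℕ) :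
    ∃ y : Subshift T, (∀ i ≤ 0, y.1 i = p.1 i) ∧
      (∀ i : ℤ, 0 ≤ i → i ≤ n → y.1 (M + i) = x.1 i) ∧
      ∀ i : ℤ, 2 * M + n ≤ i → y.1 i = p.1 (i - (2 * M + n)) := by
  obtain ⟨w, hw1, hw2⟩ := exists_bridge hT hM p x
  obtain ⟨u, hu1, hu2⟩ := exists_bridge hT hM ((shift ^ (M + n)) w) p
  have hl : ∀ i : ℤ, i ≤ M + n → ((shift ^ (-((M + n : ℕ) : ℤ))) u).1 i = w.1 i := by
    intro i hi
    rw [shift_neg_pow_apply, hu1 _ (by push_cast; omega), shift_pow_apply, sub_add_cancel]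
  refine ⟨(shift ^ (-((M + n : ℕ) : ℤ))) u, fun i hi => ?_, fun i h0 hi => ?_, fun i hi => ?_⟩
  · rw [hl i (by omega), hw1 i hi]
  · rw [hl _ (by omega), hw2 _ (by omega)]; ring_nf
  · rw [shift_neg_pow_apply, hu2 _ (by push_cast; omega)]; push_cast; ring_nf

lemma apply_add_of_shift_pow_eq {p : Subshift T} {a : ℕ} (h : (shift ^ a) p = p) (i : ℤ) :
    p.1 (i + a) = p.1 i := by
  conv_rhs => rw [← h, shift_pow_apply]

/-- A periodic point that follows successively `z`, an excursion `y` of length `D` and `z`. -/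
lemma exists_periodic_shadow {p z y : Subshift T} {r a b b' c D : ℕ}
    (ha : (shift ^ a) p = p) (hb : (shift ^ b) p = p) (hb' : (shift ^ b') p = p)
    (hc : (shift ^ c) p = p) (hz : ∀ i : ℤ, r ≤ i.natAbs → z.1 i = p.1 i)
    (hy : ∀ i ≤ 0, y.1 i = p.1 i) (hy' : ∀ i : ℤ, D ≤ i → y.1 i = p.1 (i - D))
    (hra : r < a) (hrb : r ≤ b) (hrb' : r ≤ b') :
    ∃ q : Subshift T, (shift ^ (a + b + (D + 2 * c) + (b' + a))) q = q ∧
      (∀ i : ℤ, -(a - r : ℤ) ≤ i → i ≤ a + b + c → q.1 i = z.1 (i - a)) ∧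
      (∀ i : ℤ, a + r ≤ i → i ≤ a + b + (D + 2 * c) + b' - r → q.1 i = y.1 (i - (a + b + c))) ∧
      (∀ i : ℤ, a + b + (D + c) ≤ i → i ≤ a + b + (D + 2 * c) + (b' + a) + (a - r) →
        q.1 i = z.1 (i - (a + b + (D + 2 * c) + b'))) := by
  have pa := apply_add_of_shift_pow_eq ha
  have pb := apply_add_of_shift_pow_eq hb
  have pb' := apply_add_of_shift_pow_eq hb'
  have pc := apply_add_of_shift_pow_eq hc
  -- The first loop is centered at time `a`, the excursion starts at `a + b + c`, and the second
  -- loop is centered at `a + b + (D + 2c) + b'`. Consecutive pieces overlap where both follow the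
  -- orbit of `p`, in phase because `a`, `b`, `b'`, `c` are periods of `p`.
  set z1 : Subshift T := (shift ^ (-(a : ℤ))) z with hz1
  set y1 : Subshift T := (shift ^ (-((a + b + c : ℕ) : ℤ))) y with hy1
  set z2 : Subshift T := (shift ^ (-((a + b + (D + 2 * c) + b' : ℕ) : ℤ))) z with hz2
  have ez1 : ∀ i : ℤ, z1.1 i = z.1 (i - a) := fun i => by rw [hz1, shift_neg_pow_apply]
  have ey1 : ∀ i : ℤ, y1.1 i = y.1 (i - (a + b + c)) := fun i => by
    rw [hy1, shift_neg_pow_apply]; push_cast; rfl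
  have ez2 : ∀ i : ℤ, z2.1 i = z.1 (i - (a + b + (D + 2 * c) + b')) := fun i => by
    rw [hz2, shift_neg_pow_apply]; push_cast; rfl
  have h1 : ∀ i : ℤ, a + r ≤ i → i ≤ a + b + c → z1.1 i = y1.1 i := by
    intro i hi hi'
    have e : i - a = i - (a + b + c) + b + c := by ring
    rw [ez1, ey1, hz _ (by omega), hy _ (by omega), e, pc, pb]
  have h1t : z1.1 (a + b) = y1.1 (a + b) := h1 _ (by omega) (by omega)
  set u := glue z1 y1 (a + b) h1t with hu
  have ul : ∀ i : ℤ, i ≤ a + b + c → u.1 i = z1.1 i := fun i hi =>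
    glue_apply_left h1t hi fun j hj hj' => h1 j (by omega) hj'
  have ur : ∀ i : ℤ, a + r ≤ i → u.1 i = y1.1 i := fun i hi =>
    glue_apply_right h1t hi fun j hj hj' => h1 j hj (by omega)
  have h2 : ∀ i : ℤ, a + b + (D + c) ≤ i → i ≤ a + b + (D + 2 * c) + b' - r →
      u.1 i = z2.1 i := by
    intro i hi hi'
    have e : i - (a + b + c) - D = i - (a + b + (D + 2 * c) + b') + b' + c := by ring
    rw [ur i (by omega), ey1, ez2, hy' _ (by omega), hz _ (by omega), e, pc, pb']
  have h2t : u.1 (a + b + (D + 2 * c)) = z2.1 (a + b + (D + 2 * c)) :=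
    h2 _ (by omega) (by omega)
  set w := glue u z2 (a + b + (D + 2 * c)) h2t with hw
  have wl : ∀ i : ℤ, i ≤ a + b + (D + 2 * c) + b' - r → w.1 i = u.1 i := fun i hi =>
    glue_apply_left h2t hi fun j hj hj' => h2 j (by omega) hj'
  have wr : ∀ i : ℤ, a + b + (D + c) ≤ i → w.1 i = z2.1 i := fun i hi =>
    glue_apply_right h2t hi fun j hj hj' => h2 j hj (by omega)
  obtain ⟨L, hL⟩ : ∃ L, L = a + b + (D + 2 * c) + (b' + a) := ⟨_, rfl⟩
  have h3 : ∀ i : ℤ, -(a - r : ℤ) ≤ i → i ≤ (a - r : ℤ) → w.1 i = w.1 (i + L) := by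
    intro i hi hi'
    have e : i + L - (a + b + (D + 2 * c) + b') = i - a + a + a := by rw [hL]; push_cast; ring
    rw [wl i (by omega), ul i (by omega), wr _ (by omega), ez1, ez2, hz _ (by omega),
      hz _ (by omega), e, pa, pa]
  have h3t : w.1 0 = w.1 L := by rw [h3 0 (by omega) (by omega), zero_add]
  have hq : ∀ i : ℤ, -(a - r : ℤ) ≤ i → i ≤ L + (a - r : ℤ) →
      (periodize w L (by omega) h3t).1 i = w.1 i := fun i hi hi' =>
    periodize_apply h3t (by omega) h3 hi hi'
  refine ⟨periodize w L (by omega) h3t, by rw [← hL]; exact shift_pow_periodize .., fun i hi hi' => ?_,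
    fun i hi hi' => ?_, fun i hi hi' => ?_⟩
  · rw [hq i hi (by omega), wl i (by omega), ul i hi', ez1]
  · rw [hq i (by omega) (by omega), wl i hi', ur i hi, ey1]
  · rw [hq i (by omega) (by omega), wr i hi, ez2]

end Gluing

/-! ### Dominated maps are proximal -/

section Proximal

variable {d : ℕ}

-- For an acute angle `θ`, `‖x‖ sin θ` is the distance from `x` to the line of `y`, and Jordan's
-- inequality bounds `θ` by the sine; otherwise `‖x‖ ≤ ‖x - y‖` and `θ ≤ π` suffices.
open InnerProductGeometry in
lemma angle_le_pi_mul_norm_sub_div {E : Type*} [NormedAddCommGroup E] [InnerProductSpace ℝ E]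
    {x : E} (hx : x ≠ 0) (y : E) : angle x y ≤ Real.pi * ‖x - y‖ / ‖x‖ := by
  have hx' : 0 < ‖x‖ := norm_pos_iff.2 hx
  have hπ := Real.pi_pos
  have hs : ‖x - y‖ * ‖x - y‖ = ‖x‖ * ‖x‖ + ‖y‖ * ‖y‖ - 2 * ‖x‖ * ‖y‖ * Real.cos (angle x y) :=
    norm_sub_sq_eq_norm_sq_add_norm_sq_sub_two_mul_norm_mul_norm_mul_cos_angle x y
  have h0 := angle_nonneg x y
  rw [le_div_iff₀ hx']
  rcases le_total (angle x y) (Real.pi / 2) with h | h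
  · have h1 : ‖x‖ * Real.sin (angle x y) ≤ ‖x - y‖ := by
      refine abs_le_of_sq_le_sq' ?_ (norm_nonneg _) |>.2
      have := Real.sin_sq_add_cos_sq (angle x y)
      nlinarith [sq_nonneg (‖y‖ - ‖x‖ * Real.cos (angle x y))]
    have h2 := Real.mul_le_sin h0 h
    have h3 : angle x y ≤ Real.pi * Real.sin (angle x y) := by
      rw [div_mul_eq_mul_div, div_le_iff₀ hπ] at h2
      linarith
    calc angle x y * ‖x‖ ≤ Real.pi * Real.sin (angle x y) * ‖x‖ := by gcongr
      _ = Real.pi * (‖x‖ * Real.sin (angle x y)) := by ring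
      _ ≤ _ := by gcongr
  · have hc := Real.cos_nonpos_of_pi_div_two_le_of_le h (by linarith [angle_le_pi x y])
    have h1 : ‖x‖ ≤ ‖x - y‖ := by
      refine abs_le_of_sq_le_sq' ?_ (norm_nonneg _) |>.2
      have : 0 ≤ ‖x‖ * ‖y‖ * -Real.cos (angle x y) :=
        mul_nonneg (by positivity) (by linarith)
      nlinarith [norm_nonneg y]
    calc angle x y * ‖x‖ ≤ Real.pi * ‖x‖ := by gcongr; exact angle_le_pi x y
      _ ≤ _ := by gcongr

open InnerProductGeometry in
lemma norm_sub_le_angle {E : Type*} [NormedAddCommGroup E] [InnerProductSpace ℝ E]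
    {x y : E} (hx : ‖x‖ = 1) (hy : ‖y‖ = 1) : ‖x - y‖ ≤ angle x y := by
  have hs : ‖x - y‖ * ‖x - y‖ = ‖x‖ * ‖x‖ + ‖y‖ * ‖y‖ - 2 * ‖x‖ * ‖y‖ * Real.cos (angle x y) :=
    norm_sub_sq_eq_norm_sq_add_norm_sq_sub_two_mul_norm_mul_norm_mul_cos_angle x y
  rw [hx, hy] at hs
  refine abs_le_of_sq_le_sq' ?_ (angle_nonneg x y) |>.2
  have := Real.one_sub_sq_div_two_le_cos (x := angle x y)
  nlinarith

open InnerProductGeometry in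
lemma rho_mk {x y : Euc d} (hx : x ≠ 0) (hy : y ≠ 0) :
    rho (Projectivization.mk ℝ x hx) (Projectivization.mk ℝ y hy) =
      min (angle x y) (angle x (-y)) := by
  obtain ⟨a, ha⟩ := Projectivization.exists_smul_eq_mk_rep ℝ x hx
  obtain ⟨b, hb⟩ := Projectivization.exists_smul_eq_mk_rep ℝ y hy
  rw [rho, ← ha, ← hb, Units.smul_def, Units.smul_def]
  have key : ∀ c : ℝ, c ≠ 0 → ∀ u v : Euc d,
      min (angle (c • u) v) (angle (c • u) (-v)) = min (angle u v) (angle u (-v)) := by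
    intro c hc u v
    rcases lt_or_gt_of_ne hc with h | h
    · rw [angle_smul_left_of_neg _ _ h, angle_smul_left_of_neg _ _ h, angle_neg_neg, min_comm,
        ← angle_neg_neg (-u) v, neg_neg]
    · rw [angle_smul_left_of_pos _ _ h, angle_smul_left_of_pos _ _ h]
  have comm : ∀ u v : Euc d, min (angle u v) (angle u (-v)) = min (angle v u) (angle v (-u)) := by
    intro u v
    rw [angle_comm u v, ← angle_neg_neg u (-v), neg_neg, angle_comm (-u) v]
  rw [key _ a.ne_zero, comm, key _ b.ne_zero, comm]

lemma rho_nonneg (u v : Proj d) : 0 ≤ rho u v :=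
  le_min (InnerProductGeometry.angle_nonneg _ _) (InnerProductGeometry.angle_nonneg _ _)

lemma rho_comm (u v : Proj d) : rho u v = rho v u := by
  open InnerProductGeometry in
  rw [rho, rho, angle_comm u.rep v.rep, ← angle_neg_neg u.rep, neg_neg, angle_comm (-u.rep)]

lemma rho_mk_le {x y : Euc d} (hx : x ≠ 0) (hy : y ≠ 0) :
    rho (Projectivization.mk ℝ x hx) (Projectivization.mk ℝ y hy) ≤
      Real.pi * ‖x - y‖ / ‖x‖ := by
  rw [rho_mk]
  exact (min_le_left _ _).trans (angle_le_pi_mul_norm_sub_div hx y)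

/-- Unit representatives at distance at most the angular distance. -/
lemma exists_unit_reps (u v : Proj d) :
    ∃ (a b : Euc d) (ha : ‖a‖ = 1) (hb : ‖b‖ = 1),
      u = Projectivization.mk ℝ a (norm_ne_zero_iff.1 (by simp [ha])) ∧
      v = Projectivization.mk ℝ b (norm_ne_zero_iff.1 (by simp [hb])) ∧ ‖a - b‖ ≤ rho u v := by
  have unit : ∀ u : Proj d, ∃ (a : Euc d) (ha : ‖a‖ = 1),
      u = Projectivization.mk ℝ a (norm_ne_zero_iff.1 (by simp [ha])) := by
    intro u
    have h : ‖u.rep‖ ≠ 0 := norm_ne_zero_iff.2 u.rep_nonzero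
    refine ⟨‖u.rep‖⁻¹ • u.rep, by rw [norm_smul, norm_inv, norm_norm, inv_mul_cancel₀ h], ?_⟩
    conv_lhs => rw [← u.mk_rep]
    rw [Projectivization.mk_eq_mk_iff']
    exact ⟨‖u.rep‖, by rw [smul_smul, mul_inv_cancel₀ h, one_smul]⟩
  obtain ⟨a, ha, rfl⟩ := unit u
  obtain ⟨b, hb, rfl⟩ := unit v
  have hb0 : b ≠ 0 := norm_ne_zero_iff.1 (by simp [hb])
  have ha0 : a ≠ 0 := norm_ne_zero_iff.1 (by simp [ha])
  rcases le_total (InnerProductGeometry.angle a b) (InnerProductGeometry.angle a (-b)) with h | h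
  · refine ⟨a, b, ha, hb, rfl, rfl, ?_⟩
    rw [rho_mk ha0 hb0, min_eq_left h]
    exact norm_sub_le_angle ha hb
  · refine ⟨a, -b, ha, by rwa [norm_neg], rfl, ?_, ?_⟩
    · rw [Projectivization.mk_eq_mk_iff']
      exact ⟨-1, by simp⟩
    · rw [rho_mk ha0 hb0, min_eq_right h]
      exact norm_sub_le_angle ha (by rwa [norm_neg])

/-- The vectors are the real and imaginary parts of a complex eigenvector, which lets norms be
estimated in the real space. -/
lemma exists_real_pair_of_isRoot_charpoly {V : Type*} [AddCommGroup V] [Module ℝ V]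
    [FiniteDimensional ℝ V] (f : V →ₗ[ℝ] V) {ν : ℂ}
    (hν : (f.charpoly.map (algebraMap ℝ ℂ)).IsRoot ν) :
    ∃ x y : V, (x ≠ 0 ∨ y ≠ 0) ∧ f x = ν.re • x - ν.im • y ∧ f y = ν.im • x + ν.re • y := by
  classical
  let b := Module.finBasis ℝ V
  set M := LinearMap.toMatrix b b f with hM
  rw [← LinearMap.charpoly_toMatrix f b, ← Matrix.charpoly_map, Polynomial.IsRoot,
    Matrix.eval_charpoly, ← Matrix.exists_mulVec_eq_zero_iff] at hν
  obtain ⟨c, hc, h⟩ := hν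
  rw [Matrix.sub_mulVec, sub_eq_zero] at h
  have hfx : ∀ u : Fin (Module.finrank ℝ V) → ℝ, ∀ i,
      b.equivFun (f (b.equivFun.symm u)) i = ∑ j, M i j * u j := by
    intro u i
    have := congrFun (LinearMap.toMatrix_mulVec_repr b b f (b.equivFun.symm u)) i
    rw [Module.Basis.equivFun_apply, ← this, ← Module.Basis.equivFun_apply,
      LinearEquiv.apply_symm_apply]
    rfl
  have hi : ∀ i, ν * c i = ∑ j, (M i j : ℂ) * c j := by
    intro i
    have := congrFun h i
    simpa [Matrix.mulVec, dotProduct, Matrix.scalar_apply, Matrix.diagonal_apply] using this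
  refine ⟨b.equivFun.symm fun i => (c i).re, b.equivFun.symm fun i => (c i).im, ?_, ?_, ?_⟩
  · by_contra hne
    push Not at hne
    refine hc (funext fun i => Complex.ext ?_ ?_)
    · simpa using congrFun ((LinearEquiv.map_eq_zero_iff _).1 hne.1) i
    · simpa using congrFun ((LinearEquiv.map_eq_zero_iff _).1 hne.2) i
  · apply b.equivFun.injective
    funext i
    rw [hfx]
    have := congrArg Complex.re (hi i)
    simp only [Complex.re_sum, Complex.mul_re, Complex.ofReal_re, Complex.ofReal_im, zero_mul,
      sub_zero] at this
    simp [-Module.Basis.equivFun_apply, this]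
  · apply b.equivFun.injective
    funext i
    rw [hfx]
    have := congrArg Complex.im (hi i)
    simp only [Complex.im_sum, Complex.mul_im, Complex.ofReal_re, Complex.ofReal_im, zero_mul,
      add_zero] at this
    simp [-Module.Basis.equivFun_apply, ← this, add_comm]

/-- The line of `w` is invariant under `g`, with eigenvalue `μ`, the complementary hyperplane
`ker ξ` is invariant too, and the norm of `g` there is at most `η |μ|`. -/
structure IsDominated (g : GLd d) (μ η : ℝ) (w : Euc d) (ξ : Euc d →L[ℝ] ℝ) : Prop where
  ne_zero : μ ≠ 0
  eta_nonneg : 0 ≤ η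
  eta_lt_one : η < 1
  pairing : ξ w = 1
  eigen : g w = μ • w
  coeigen : ∀ x, ξ (g x) = μ * ξ x
  norm_le : ∀ x, ξ x = 0 → ‖g x‖ ≤ |μ| * η * ‖x‖

lemma IsDominated.isDominantEigenvalue {g : GLd d} {μ η : ℝ} {w : Euc d} {ξ : Euc d →L[ℝ] ℝ}
    (h : IsDominated g μ η w ξ) : IsDominantEigenvalue g (μ : ℂ) := by
  have hμ : 0 < |μ| := abs_pos.2 h.ne_zero
  have hw0 : w ≠ 0 := by
    rintro rfl; simpa using h.pairing
  set f : Euc d →ₗ[ℝ] Euc d := (g.toOp : Euc d →ₗ[ℝ] Euc d) with hf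
  have hfg : ∀ x, f x = g x := fun _ => rfl
  -- On the invariant hyperplane `g` has norm below `|μ|`, so `g - μ` and all its powers are
  -- injective there. This excludes generalized eigenvectors outside the line of `w`.
  have hinj : ∀ (k : ℕ) (y : Euc d), ξ y = 0 →
      ((f - algebraMap ℝ (Module.End ℝ (Euc d)) μ) ^ k) y = 0 → y = 0 := by
    intro k
    induction k with
    | zero => intro y _ hy; simpa using hy
    | succ k ih =>
      intro y hy hk
      rw [pow_succ, Module.End.mul_apply] at hk
      have h1 := ih _ (by simp [hfg, h.coeigen, hy, Module.algebraMap_end_apply]) hk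
      have h2 : g y = μ • y := by
        simpa [sub_eq_zero, hfg, Module.algebraMap_end_apply] using h1
      have h3 := h.norm_le y hy
      rw [h2, norm_smul, Real.norm_eq_abs] at h3
      by_contra hne
      have : 0 < |μ| * ‖y‖ := mul_pos hμ (norm_pos_iff.2 hne)
      nlinarith [h.eta_lt_one]
  have hgen : Module.End.maxGenEigenspace f μ = Submodule.span ℝ {w} := by
    have hw : (f - algebraMap ℝ (Module.End ℝ (Euc d)) μ) w = 0 := by
      simp [hfg, h.eigen, Module.algebraMap_end_apply]
    apply le_antisymm
    · intro x hx
      obtain ⟨k, hk⟩ := (Module.End.mem_maxGenEigenspace f μ x).1 hx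
      rw [← Algebra.algebraMap_eq_smul_one] at hk
      have hy : x - ξ x • w = 0 := by
        refine hinj (k + 1) _ (by simp [h.pairing]) ?_
        rw [map_sub, map_smul, pow_succ, Module.End.mul_apply, Module.End.mul_apply, hw, map_zero,
          smul_zero, sub_zero, ← Module.End.mul_apply, ← pow_succ, pow_succ', Module.End.mul_apply,
          hk, map_zero]
      rw [sub_eq_zero.1 hy]
      exact Submodule.smul_mem _ _ (Submodule.mem_span_singleton_self w)
    · rw [Submodule.span_singleton_le_iff_mem, Module.End.mem_maxGenEigenspace]
      exact ⟨1, by rw [pow_one, ← Algebra.algebraMap_eq_smul_one, hw]⟩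
  refine ⟨?_, fun ν hν hne => ?_⟩
  · have h1 := Polynomial.eq_rootMultiplicity_map (p := f.charpoly) (algebraMap ℝ ℂ).injective μ
    rw [← LinearMap.finrank_maxGenEigenspace_eq, hgen, finrank_span_singleton hw0] at h1
    exact h1.symm
  · obtain ⟨x, y, hxy, hx, hy⟩ := exists_real_pair_of_isRoot_charpoly f hν
    rw [hfg] at hx hy
    have ex := h.coeigen x
    have ey := h.coeigen y
    rw [hx] at ex
    rw [hy] at ey
    simp only [map_sub, map_add, map_smul, smul_eq_mul] at ex ey
    have hpos : 0 < (ν.re - μ) ^ 2 + ν.im ^ 2 := by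
      by_contra hle
      have h1 : ν.re - μ = 0 := by nlinarith [sq_nonneg (ν.re - μ), sq_nonneg ν.im]
      have h2 : ν.im = 0 := by nlinarith [sq_nonneg (ν.re - μ), sq_nonneg ν.im]
      exact hne (Complex.ext (by simpa using sub_eq_zero.1 h1) (by simpa using h2))
    -- The two equations are the real and imaginary parts of `(ν - μ) (ξ x + i ξ y) = 0`, and `ν ≠
    -- μ`.
    have hx0 : ξ x = 0 := by
      have : ((ν.re - μ) ^ 2 + ν.im ^ 2) * ξ x = 0 := by
        linear_combination (ν.re - μ) * ex + ν.im * ey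
      exact (mul_eq_zero.1 this).resolve_left hpos.ne'
    have hy0 : ξ y = 0 := by
      have : ((ν.re - μ) ^ 2 + ν.im ^ 2) * ξ y = 0 := by
        linear_combination (ν.re - μ) * ey - ν.im * ex
      exact (mul_eq_zero.1 this).resolve_left hpos.ne'
    have nx := h.norm_le x hx0
    have ny := h.norm_le y hy0
    -- The inner products of `x` and `y` cancel in the sum, so the pair is scaled by exactly `|ν|`.
    have hsum : ‖g x‖ ^ 2 + ‖g y‖ ^ 2 = (ν.re ^ 2 + ν.im ^ 2) * (‖x‖ ^ 2 + ‖y‖ ^ 2) := by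
      rw [hx, hy, norm_sub_sq_real, norm_add_sq_real]
      simp only [norm_smul, inner_smul_left, inner_smul_right, mul_pow, Real.norm_eq_abs, sq_abs,
        conj_trivial]
      ring
    have hS : 0 < ‖x‖ ^ 2 + ‖y‖ ^ 2 := by
      rcases hxy with h1 | h1
      · have := norm_pos_iff.2 h1; positivity
      · have := norm_pos_iff.2 h1; positivity
    have hle : (ν.re ^ 2 + ν.im ^ 2) * (‖x‖ ^ 2 + ‖y‖ ^ 2) ≤
        (|μ| * η) ^ 2 * (‖x‖ ^ 2 + ‖y‖ ^ 2) := by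
      rw [← hsum, mul_add, ← mul_pow, ← mul_pow]
      gcongr
    have h2 := le_of_mul_le_mul_right hle hS
    have h3 : ‖ν‖ ^ 2 ≤ (|μ| * η) ^ 2 := by
      rw [Complex.sq_norm, Complex.normSq_apply]; nlinarith
    have h4 : ‖ν‖ ≤ |μ| * η := abs_le_of_sq_le_sq' h3 (mul_nonneg hμ.le h.eta_nonneg) |>.2
    rw [Complex.norm_real, Real.norm_eq_abs]
    nlinarith [h.eta_lt_one]


lemma projAct_mk (g : GLd d) {x : Euc d} (hx : x ≠ 0) :
    projAct g (Projectivization.mk ℝ x hx) =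
      Projectivization.mk ℝ (g x) ((map_ne_zero_iff g g.injective).2 hx) :=
  Projectivization.map_mk _ _ _ _

lemma add_self_mul_self_le {x y : ℝ} (h1 : 1 ≤ x) (h2 : x ≤ y) : x + x * x ≤ 2 * y ^ 2 := by
  nlinarith

namespace IsDominated

variable {g : GLd d} {μ η : ℝ} {w : Euc d} {ξ : Euc d →L[ℝ] ℝ} (h : IsDominated g μ η w ξ)
include h

lemma vec_ne_zero : w ≠ 0 := by
  rintro rfl; simpa using h.pairing

lemma one_le : 1 ≤ ‖w‖ * ‖ξ‖ := by
  have := ξ.le_opNorm w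
  rw [h.pairing, norm_one] at this
  linarith

/-- The functional `ξ` vanishes on `u` and equals `1 / ‖w‖` in modulus at a unit vector on the line
of `w`; these values cannot differ by more than `‖ξ‖` times the chord, which is at most the angle.
-/
lemma inv_le_rho {u : Proj d} (hu : u ∈ projSubspace (LinearMap.ker (ξ : Euc d →ₗ[ℝ] ℝ))) :
    (‖w‖ * ‖ξ‖)⁻¹ ≤ rho (Projectivization.mk ℝ w h.vec_ne_zero) u := by
  obtain ⟨a, b, ha, hb, e1, rfl, hab⟩ := exists_unit_reps (Projectivization.mk ℝ w h.vec_ne_zero) u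
  refine le_trans ?_ hab
  have hw : 0 < ‖w‖ := norm_pos_iff.2 h.vec_ne_zero
  have hξ : 0 < ‖ξ‖ := by
    by_contra h0
    have : ‖ξ‖ = 0 := le_antisymm (not_lt.1 h0) (norm_nonneg _)
    have := h.one_le
    simp_all
    linarith
  obtain ⟨t, ht⟩ := (Projectivization.mk_eq_mk_iff' ℝ _ _ _ _).1 e1
  have htw : |t| = ‖w‖ := by
    rw [← ht, norm_smul, ha, mul_one, Real.norm_eq_abs]
  have hb0 : ξ b = 0 := by
    have : b ∈ (Projectivization.mk ℝ b (norm_ne_zero_iff.1 (by simp [hb]))).submodule := by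
      rw [Projectivization.submodule_mk]; exact Submodule.mem_span_singleton_self b
    exact hu this
  have hξa : |ξ a| * ‖w‖ = 1 := by
    have h1 := h.pairing
    rw [← ht, map_smul, smul_eq_mul] at h1
    rw [← htw, ← abs_mul, mul_comm, h1, abs_one]
  have h2 := ξ.le_opNorm (a - b)
  rw [map_sub, hb0, sub_zero, Real.norm_eq_abs] at h2
  rw [inv_le_iff_one_le_mul₀ (by positivity)]
  calc (1 : ℝ) = |ξ a| * ‖w‖ := hξa.symm
    _ ≤ ‖ξ‖ * ‖a - b‖ * ‖w‖ := by gcongr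
    _ = _ := by ring

/-- The projection `a - ξ(a) w` lies in the hyperplane at distance `|ξ a| ‖w‖` from `a`. If it
vanishes it defines no projective point, but then `|ξ a| ‖w‖ = 1`. -/
lemma le_abs_of_notMem_cone {τ : ℝ} (hτπ : τ < Real.pi) {a : Euc d} (ha : ‖a‖ = 1)
    (hK : Projectivization.mk ℝ a (norm_ne_zero_iff.1 (by simp [ha])) ∉
      cone (projSubspace (LinearMap.ker (ξ : Euc d →ₗ[ℝ] ℝ))) τ) :
    τ ≤ Real.pi * (|ξ a| * ‖w‖) := by
  have ha0 : a ≠ 0 := norm_ne_zero_iff.1 (by simp [ha])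
  have hn : ‖a - (a - ξ a • w)‖ = |ξ a| * ‖w‖ := by
    rw [sub_sub_cancel, norm_smul, Real.norm_eq_abs]
  by_cases hb : a - ξ a • w = 0
  · rw [hb, sub_zero, ha] at hn
    rw [← hn, mul_one]
    exact hτπ.le
  · have hmem : Projectivization.mk ℝ _ hb ∈
        projSubspace (LinearMap.ker (ξ : Euc d →ₗ[ℝ] ℝ)) := by
      change Projectivization.submodule _ ≤ _
      rw [Projectivization.submodule_mk, Submodule.span_singleton_le_iff_mem]
      simp [h.pairing]
    have h1 : ENNReal.ofReal τ < rhoSet (Projectivization.mk ℝ a ha0)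
      (projSubspace (LinearMap.ker (ξ : Euc d →ₗ[ℝ] ℝ))) := not_le.1 hK
    have h2 : ENNReal.ofReal τ < ENNReal.ofReal (rho (Projectivization.mk ℝ a ha0)
        (Projectivization.mk ℝ _ hb)) := h1.trans_le (iInf₂_le _ hmem)
    have h4 := rho_mk_le ha0 hb
    rw [hn, ha, div_one] at h4
    exact (ENNReal.ofReal_lt_ofReal_iff'.1 h2).1.le.trans h4

/-- Rescale representatives to `ξ = 1`. Their difference lies in `ker ξ`, where `g` has norm at most
`|μ| η`, while their images have norm at least `|μ| / ‖ξ‖`. Outside the cone the rescaling costs a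
factor of order `1 / τ` for each point, whence a Lipschitz constant at most `2 π³ B² η / τ²`. -/
lemma rhoNormOn_le {τ B : ℝ} (hτ : 0 < τ) (hB : ‖w‖ * ‖ξ‖ ≤ B) (hτB : 2 * τ * B ≤ 1)
    (hη : η ≤ τ ^ 3 / (2 * Real.pi ^ 3 * B ^ 2)) :
    rhoNormOn g (cone (projSubspace (LinearMap.ker (ξ : Euc d →ₗ[ℝ] ℝ))) τ)ᶜ ≤
      ENNReal.ofReal τ := by
  have hw0 := h.vec_ne_zero
  have hβ := h.one_le
  have hB1 : 1 ≤ B := hβ.trans hB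
  have hπ := Real.pi_gt_three
  have hw : 0 < ‖w‖ := norm_pos_iff.2 hw0
  have hξ : 0 < ‖ξ‖ := by
    by_contra h0
    have : ‖ξ‖ = 0 := le_antisymm (not_lt.1 h0) (norm_nonneg _)
    rw [this] at hβ
    linarith
  have hμ : 0 < |μ| := abs_pos.2 h.ne_zero
  have hη0 := h.eta_nonneg
  have hτ1 : τ ≤ 1 / 2 := by nlinarith
  have hη' : η * (2 * Real.pi ^ 3 * B ^ 2) ≤ τ ^ 3 := by
    rwa [le_div_iff₀ (by positivity)] at hη
  have hT : ∀ {a : Euc d} (ha : ‖a‖ = 1), Projectivization.mk ℝ a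
      (norm_ne_zero_iff.1 (by simp [ha])) ∉
      cone (projSubspace (LinearMap.ker (ξ : Euc d →ₗ[ℝ] ℝ))) τ →
      0 < |ξ a| ∧ |ξ a|⁻¹ ≤ Real.pi * ‖w‖ / τ := by
    intro a ha hK
    have h1 := h.le_abs_of_notMem_cone (by linarith) ha hK
    have h2 : 0 < |ξ a| := by
      rw [abs_pos]; intro h0; rw [h0] at h1; simp at h1; linarith
    refine ⟨h2, ?_⟩
    rw [inv_le_iff_one_le_mul₀ h2, div_mul_eq_mul_div, le_div_iff₀ hτ]
    linarith
  refine iSup₂_le fun u hu => iSup₂_le fun v hv => iSup_le fun _ =>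
    ENNReal.ofReal_le_ofReal (div_le_of_le_mul₀ (rho_nonneg _ _) hτ.le ?_)
  obtain ⟨a, b, ha, hb, rfl, rfl, hab⟩ := exists_unit_reps u v
  obtain ⟨hξa, hia⟩ := hT ha hu
  obtain ⟨hξb, hib⟩ := hT hb hv
  have ha0 : a ≠ 0 := norm_ne_zero_iff.1 (by simp [ha])
  have hb0 : b ≠ 0 := norm_ne_zero_iff.1 (by simp [hb])
  have za : ξ a ≠ 0 := abs_pos.1 hξa
  have zb : ξ b ≠ 0 := abs_pos.1 hξb
  have hga : g ((ξ a)⁻¹ • a) ≠ 0 :=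
    (map_ne_zero_iff g g.injective).2 (smul_ne_zero (inv_ne_zero za) ha0)
  have hgb : g ((ξ b)⁻¹ • b) ≠ 0 :=
    (map_ne_zero_iff g g.injective).2 (smul_ne_zero (inv_ne_zero zb) hb0)
  have ea : projAct g (Projectivization.mk ℝ a ha0) = Projectivization.mk ℝ _ hga := by
    rw [projAct_mk, eq_comm, Projectivization.mk_eq_mk_iff']
    exact ⟨(ξ a)⁻¹, by rw [map_smul]⟩
  have eb : projAct g (Projectivization.mk ℝ b hb0) = Projectivization.mk ℝ _ hgb := by
    rw [projAct_mk, eq_comm, Projectivization.mk_eq_mk_iff']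
    exact ⟨(ξ b)⁻¹, by rw [map_smul]⟩
  rw [ea, eb]
  refine (rho_mk_le hga hgb).trans ?_
  rw [← map_sub]
  have hn := h.norm_le ((ξ a)⁻¹ • a - (ξ b)⁻¹ • b) (by simp [za, zb])
  have hl : |μ| / ‖ξ‖ ≤ ‖g ((ξ a)⁻¹ • a)‖ := by
    rw [div_le_iff₀ hξ]
    have := ξ.le_opNorm (g ((ξ a)⁻¹ • a))
    rw [h.coeigen, map_smul, smul_eq_mul, inv_mul_cancel₀ za, mul_one, Real.norm_eq_abs] at this
    linarith
  have hd : ‖(ξ a)⁻¹ • a - (ξ b)⁻¹ • b‖ ≤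
      (|ξ a|⁻¹ + ‖ξ‖ * (|ξ a|⁻¹ * |ξ b|⁻¹)) * ‖a - b‖ := by
    have e : (ξ a)⁻¹ • a - (ξ b)⁻¹ • b =
        (ξ a)⁻¹ • (a - b) - ((ξ a)⁻¹ * (ξ b)⁻¹ * ξ (a - b)) • b := by
      have : (ξ a)⁻¹ * (ξ b)⁻¹ * ξ (a - b) = (ξ b)⁻¹ - (ξ a)⁻¹ := by
        rw [map_sub]; field_simp
      rw [this]; module
    rw [e]
    refine (norm_sub_le _ _).trans ?_
    rw [norm_smul, norm_smul, hb, norm_mul, norm_mul, norm_inv, norm_inv, Real.norm_eq_abs,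
      Real.norm_eq_abs]
    have := ξ.le_opNorm (a - b)
    calc _ ≤ |ξ a|⁻¹ * ‖a - b‖ + |ξ a|⁻¹ * |ξ b|⁻¹ * (‖ξ‖ * ‖a - b‖) * 1 := by gcongr
      _ = _ := by ring
  set β := ‖w‖ * ‖ξ‖ with hβd
  calc Real.pi * ‖g ((ξ a)⁻¹ • a - (ξ b)⁻¹ • b)‖ / ‖g ((ξ a)⁻¹ • a)‖
      ≤ Real.pi * (|μ| * η * ((|ξ a|⁻¹ + ‖ξ‖ * (|ξ a|⁻¹ * |ξ b|⁻¹)) * ‖a - b‖)) /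
        (|μ| / ‖ξ‖) := by
        gcongr
        exact hn.trans (by gcongr)
    _ = Real.pi * η * (‖ξ‖ * |ξ a|⁻¹ + (‖ξ‖ * |ξ a|⁻¹) * (‖ξ‖ * |ξ b|⁻¹)) * ‖a - b‖ := by
        field_simp
    _ ≤ Real.pi * η * (‖ξ‖ * (Real.pi * ‖w‖ / τ) +
        (‖ξ‖ * (Real.pi * ‖w‖ / τ)) * (‖ξ‖ * (Real.pi * ‖w‖ / τ))) * ‖a - b‖ := by gcongr
    _ = Real.pi * η * (Real.pi * β / τ + (Real.pi * β / τ) * (Real.pi * β / τ)) * ‖a - b‖ := by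
        rw [hβd]; ring
    _ ≤ τ * ‖a - b‖ := by
        gcongr
        have h1 : 1 ≤ Real.pi * β / τ := by
          rw [one_le_div hτ]; nlinarith
        have h2 : Real.pi * β / τ ≤ Real.pi * B / τ := by gcongr
        calc _ ≤ Real.pi * η * (2 * (Real.pi * B / τ) ^ 2) := by
              gcongr; exact add_self_mul_self_le h1 h2
          _ = η * (2 * Real.pi ^ 3 * B ^ 2) / τ ^ 2 := by field_simp
          _ ≤ τ := by
            rw [div_le_iff₀ (by positivity)]
            linarith
    _ ≤ _ := by gcongr

lemma isEpsProximal {τ B : ℝ} (hτ : 0 < τ) (hB : ‖w‖ * ‖ξ‖ ≤ B) (hτB : 2 * τ * B ≤ 1)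
    (hη : η ≤ τ ^ 3 / (2 * Real.pi ^ 3 * B ^ 2)) : IsEpsProximal τ g := by
  have hw0 := h.vec_ne_zero
  have hβ := h.one_le
  have hB1 : 1 ≤ B := hβ.trans hB
  have hπ := Real.pi_gt_three
  have hw : 0 < ‖w‖ := norm_pos_iff.2 hw0
  have hξ : 0 < ‖ξ‖ := by
    by_contra h0
    have : ‖ξ‖ = 0 := le_antisymm (not_lt.1 h0) (norm_nonneg _)
    rw [this] at hβ
    linarith
  have hμ : 0 < |μ| := abs_pos.2 h.ne_zero
  have hη0 := h.eta_nonneg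
  have hτ1 : τ ≤ 1 / 2 := by nlinarith
  have hη' : η * (2 * Real.pi ^ 3 * B ^ 2) ≤ τ ^ 3 := by
    rwa [le_div_iff₀ (by positivity)] at hη
  have hT : ∀ {a : Euc d} (ha : ‖a‖ = 1), Projectivization.mk ℝ a
      (norm_ne_zero_iff.1 (by simp [ha])) ∉
      cone (projSubspace (LinearMap.ker (ξ : Euc d →ₗ[ℝ] ℝ))) τ →
      0 < |ξ a| ∧ |ξ a|⁻¹ ≤ Real.pi * ‖w‖ / τ := by
    intro a ha hK
    have h1 := h.le_abs_of_notMem_cone (by linarith) ha hK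
    have h2 : 0 < |ξ a| := by
      rw [abs_pos]; intro h0; rw [h0] at h1; simp at h1; linarith
    refine ⟨h2, ?_⟩
    rw [inv_le_iff_one_le_mul₀ h2, div_mul_eq_mul_div, le_div_iff₀ hτ]
    linarith
  refine ⟨⟨μ, h.isDominantEigenvalue⟩, μ, Projectivization.mk ℝ w hw0,
    LinearMap.ker (ξ : Euc d →ₗ[ℝ] ℝ), h.isDominantEigenvalue, ?_, ?_, ?_, ?_, ?_, ?_⟩
  · rw [Projectivization.submodule_mk, Submodule.span_singleton_le_iff_mem,
      Module.End.mem_eigenspace_iff]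
    exact h.eigen
  · rw [Projectivization.submodule_mk, isCompl_iff]
    constructor
    · rw [Submodule.disjoint_def]
      intro x hx hx'
      obtain ⟨t, rfl⟩ := Submodule.mem_span_singleton.1 hx
      have : t = 0 := by simpa [h.pairing] using hx'
      rw [this, zero_smul]
    · rw [codisjoint_iff, eq_top_iff]
      intro x _
      refine Submodule.mem_sup.2 ⟨ξ x • w, Submodule.smul_mem _ _
        (Submodule.mem_span_singleton_self w), x - ξ x • w, ?_, by simp⟩
      simp [h.pairing]
  · rintro _ ⟨x, hx, rfl⟩
    have hx0 : ξ x = 0 := hx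
    change ξ (g x) = 0
    rw [h.coeigen, hx0, mul_zero]
  · refine le_iInf₂ fun u hu => ENNReal.ofReal_le_ofReal (le_trans ?_ (h.inv_le_rho hu))
    rw [← one_div, le_div_iff₀ (by positivity)]
    nlinarith
  · rintro _ ⟨u, hu, rfl⟩
    obtain ⟨a, -, ha, -, rfl, -, -⟩ := exists_unit_reps u u
    obtain ⟨hξa, hξi⟩ := hT ha hu
    have ha0 : a ≠ 0 := norm_ne_zero_iff.1 (by simp [ha])
    have hx0 : (μ * ξ a) • w ≠ 0 := smul_ne_zero (mul_ne_zero h.ne_zero (abs_pos.1 hξa)) hw0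
    change rhoSet _ _ ≤ _
    rw [rhoSet, iInf_singleton]
    refine ENNReal.ofReal_le_ofReal ?_
    -- Representing the eigenline by the `w`-component of `g a` makes its difference with `g a` the
    -- image of a vector of `ker ξ`.
    have e : Projectivization.mk ℝ w hw0 = Projectivization.mk ℝ ((μ * ξ a) • w) hx0 := by
      symm
      rw [Projectivization.mk_eq_mk_iff']
      exact ⟨μ * ξ a, rfl⟩
    rw [rho_comm, e, projAct_mk]
    refine (rho_mk_le hx0 _).trans ?_
    have e2 : (μ * ξ a) • w - g a = -g (a - ξ a • w) := by
      rw [map_sub, map_smul, h.eigen, smul_smul, mul_comm]; abel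
    have hb : ‖a - ξ a • w‖ ≤ 2 * B := by
      have h1 : ‖ξ a • w‖ ≤ ‖ξ‖ * ‖w‖ := by
        rw [norm_smul]
        have := ξ.le_opNorm a
        rw [ha, mul_one] at this
        gcongr
      have := norm_sub_le a (ξ a • w)
      linarith
    have h3 := h.norm_le (a - ξ a • w) (by simp [h.pairing])
    rw [e2, norm_neg, norm_smul, norm_mul, Real.norm_eq_abs, Real.norm_eq_abs]
    calc Real.pi * ‖g (a - ξ a • w)‖ / (|μ| * |ξ a| * ‖w‖)
        ≤ Real.pi * (|μ| * η * (2 * B)) / (|μ| * |ξ a| * ‖w‖) := by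
          gcongr; exact h3.trans (by gcongr)
      _ = 2 * Real.pi * η * B / ‖w‖ * |ξ a|⁻¹ := by field_simp
      _ ≤ 2 * Real.pi * η * B / ‖w‖ * (Real.pi * ‖w‖ / τ) := by gcongr
      _ = η * (2 * Real.pi ^ 2 * B) / τ := by field_simp
      _ ≤ τ := by
        rw [div_le_iff₀ hτ]
        calc η * (2 * Real.pi ^ 2 * B) ≤ η * (2 * Real.pi ^ 3 * B ^ 2) := by
              gcongr
              · linarith
              · norm_num
              · nlinarith
          _ ≤ τ ^ 3 := hη'
          _ ≤ τ * τ := by nlinarith [mul_pos hτ hτ]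
  · exact h.rhoNormOn_le hτ hB hτB hη

end IsDominated
end Proximal

/-! ### Perturbations of a projection of rank one -/

/-- A small perturbation of the rank-one projection `x ↦ f x • v` has an eigenvector near `v`. -/
lemma exists_eigenvector_near {E : Type*} [NormedAddCommGroup E] [NormedSpace ℝ E]
    [CompleteSpace E] {v : E} {f : E →L[ℝ] ℝ} {e : E →L[ℝ] E} {B δ : ℝ} (hB : 1 ≤ B)
    (hfv : f v = 1) (hv : ‖v‖ ≤ B) (hf : ‖f‖ ≤ B) (he : ‖e‖ ≤ δ) (hδ : 20 * B ^ 3 * δ ≤ 1) :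
    ∃ (w : E) (k : ℝ), f w = 1 ∧ ‖w - v‖ ≤ 8 * B ^ 3 * δ ∧ 1 / 2 ≤ k ∧ v + e w = k • w := by
  have hδ0 : 0 ≤ δ := (norm_nonneg e).trans he
  have hB2 : B ≤ B ^ 2 := by nlinarith
  have hB3 : B ^ 2 ≤ B ^ 3 := by nlinarith [sq_nonneg B]
  have hBδ : B ^ 2 * δ ≤ B ^ 3 * δ := by gcongr
  have hBδ' : B * δ ≤ B ^ 3 * δ := by gcongr; linarith
  have hδδ : δ ≤ B ^ 3 * δ := by nlinarith
  -- On the slice `f = 1` the perturbed operator sends `w` to `v + e w`; dividing by the value of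
  -- `f` returns to the slice. This is the projective action in an affine chart, and its fixed point
  -- is the eigenvector.
  set F : E → E := fun w => (1 + f (e w))⁻¹ • (v + e w) with hF
  set s : Set E := {w | f w = 1 ∧ ‖w - v‖ ≤ 8 * B ^ 3 * δ} with hs
  have hnorm : ∀ w ∈ s, ‖w‖ ≤ 2 * B := by
    intro w hw
    have h1 : ‖w‖ ≤ ‖w - v‖ + ‖v‖ := by simpa using norm_add_le (w - v) v
    have := hw.2
    linarith
  have hen : ∀ w ∈ s, ‖e w‖ ≤ 2 * B * δ := by
    intro w hw
    calc ‖e w‖ ≤ ‖e‖ * ‖w‖ := e.le_opNorm w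
      _ ≤ δ * (2 * B) := by gcongr; exact hnorm w hw
      _ = _ := by ring
  have hfe : ∀ w ∈ s, |f (e w)| ≤ 2 * B ^ 2 * δ := by
    intro w hw
    calc |f (e w)| ≤ ‖f‖ * ‖e w‖ := f.le_opNorm _
      _ ≤ B * (2 * B * δ) := by gcongr; exact hen w hw
      _ = _ := by ring
  have hk : ∀ w ∈ s, 1 / 2 ≤ 1 + f (e w) := by
    intro w hw
    have := (abs_le.1 (hfe w hw)).1
    linarith
  have hkinv : ∀ w ∈ s, |(1 + f (e w))⁻¹| ≤ 2 := by
    intro w hw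
    have := hk w hw
    rw [abs_inv, abs_of_pos (by linarith)]
    exact inv_le_of_inv_le₀ (by norm_num) (by linarith)
  have hmaps : Set.MapsTo F s s := by
    intro w hw
    have h0 : (1 + f (e w)) ≠ 0 := by have := hk w hw; positivity
    refine ⟨?_, ?_⟩
    · simp only [hF, map_smul, map_add, hfv, smul_eq_mul]
      exact inv_mul_cancel₀ h0
    have e1 : F w - v = (1 + f (e w))⁻¹ • (e w - f (e w) • v) := by
      have hv' : (1 + f (e w))⁻¹ • ((1 + f (e w)) • v) = v := inv_smul_smul₀ h0 v
      calc F w - v = (1 + f (e w))⁻¹ • (v + e w) - (1 + f (e w))⁻¹ • ((1 + f (e w)) • v) := by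
            rw [hv']
        _ = _ := by module
    rw [e1, norm_smul]
    have h1 : ‖e w - f (e w) • v‖ ≤ 2 * B * δ + 2 * B ^ 2 * δ * B := by
      refine (norm_sub_le _ _).trans ?_
      rw [norm_smul]
      have := hen w hw
      have := hfe w hw
      rw [Real.norm_eq_abs]
      gcongr
    calc ‖(1 + f (e w))⁻¹‖ * ‖e w - f (e w) • v‖ ≤ 2 * (2 * B * δ + 2 * B ^ 2 * δ * B) := by
          gcongr; exact hkinv w hw
      _ ≤ 8 * B ^ 3 * δ := by nlinarith
  have hlip : ∀ w ∈ s, ∀ w' ∈ s, ‖F w - F w'‖ ≤ 1 / 2 * ‖w - w'‖ := by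
    intro w hw w' hw'
    have h0 := hk w hw
    have h0' := hk w' hw'
    have e1 : F w - F w' = (1 + f (e w))⁻¹ • e (w - w') +
        ((1 + f (e w))⁻¹ * (1 + f (e w'))⁻¹ * f (e (w' - w))) • (v + e w') := by
      have : (1 + f (e w))⁻¹ * (1 + f (e w'))⁻¹ * f (e (w' - w)) =
          (1 + f (e w))⁻¹ - (1 + f (e w'))⁻¹ := by
        have := (by linarith : (0 : ℝ) < 1 + f (e w)).ne'
        have := (by linarith : (0 : ℝ) < 1 + f (e w')).ne'
        rw [map_sub, map_sub]; field_simp; ring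
      rw [this, hF, map_sub]; module
    have h1 : ‖e (w - w')‖ ≤ δ * ‖w - w'‖ := (e.le_opNorm _).trans (by gcongr)
    have h2 : |f (e (w' - w))| ≤ B * (δ * ‖w - w'‖) := by
      refine (f.le_opNorm _).trans ?_
      rw [← norm_neg (e (w' - w)), ← map_neg, neg_sub]
      gcongr
    have h3 : ‖v + e w'‖ ≤ 2 * B := by
      have := norm_add_le v (e w')
      have := hen w' hw'
      nlinarith
    rw [e1]
    refine (norm_add_le _ _).trans ?_
    rw [norm_smul, norm_smul, norm_mul, norm_mul, Real.norm_eq_abs, Real.norm_eq_abs,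
      Real.norm_eq_abs]
    have h4 := hkinv w hw
    have h5 := hkinv w' hw'
    calc _ ≤ 2 * (δ * ‖w - w'‖) + 2 * 2 * (B * (δ * ‖w - w'‖)) * (2 * B) := by gcongr
      _ = (2 * δ + 8 * (B ^ 2 * δ)) * ‖w - w'‖ := by ring
      _ ≤ 1 / 2 * ‖w - w'‖ := by gcongr; linarith
  have hclosed : IsClosed s :=
    (isClosed_eq f.continuous continuous_const).inter
      (isClosed_le (continuous_id.sub continuous_const).norm continuous_const)
  have hvs : v ∈ s := ⟨hfv, by rw [sub_self, norm_zero]; positivity⟩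
  have hcontr : ContractingWith (1 / 2 : NNReal) (hmaps.restrict F s s) := by
    refine ⟨by rw [← NNReal.coe_lt_coe]; norm_num, LipschitzWith.of_dist_le_mul fun a b => ?_⟩
    rw [Subtype.dist_eq, Subtype.dist_eq, dist_eq_norm, dist_eq_norm]
    exact hlip _ a.2 _ b.2
  obtain ⟨w, hw, hfix, -⟩ :=
    hcontr.exists_fixedPoint' hclosed.isComplete hmaps hvs (edist_ne_top _ _)
  have h0 := hk w hw
  refine ⟨w, 1 + f (e w), hw.1, hw.2, h0, ?_⟩
  have h2 : (1 + f (e w))⁻¹ • (v + e w) = w := hfix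
  calc v + e w = (1 + f (e w)) • ((1 + f (e w))⁻¹ • (v + e w)) :=
        (smul_inv_smul₀ (by linarith : (0 : ℝ) < 1 + f (e w)).ne' _).symm
    _ = _ := by rw [h2]

section Perturbation

variable {d : ℕ}

/-- The invariant line and the invariant hyperplane both come from `exists_eigenvector_near`,
applied to the operator and to its transpose. On `ker ξ` the functional `φ` is small because `ξ` is
near `φ`, so the perturbed projection is small there. -/
lemma exists_isDominated_of_near {v : Euc d} {φ : Euc d →L[ℝ] ℝ} {B δ : ℝ} (hB : 1 ≤ B)
    (hφv : φ v = 1) (hv : ‖v‖ ≤ B) (hφ : ‖φ‖ ≤ B) (hδ : 32 * B ^ 4 * δ ≤ 1) {g : GLd d} {c : ℝ}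
    (hg : ‖c • g.toOp - φ.smulRight v‖ ≤ δ) :
    ∃ (μ : ℝ) (w : Euc d) (ξ : Euc d →L[ℝ] ℝ), IsDominated g μ (18 * B ^ 4 * δ) w ξ ∧
      ‖w‖ * ‖ξ‖ ≤ 8 * B ^ 2 := by
  have hδ0 : 0 ≤ δ := (norm_nonneg _).trans hg
  set e := c • g.toOp - φ.smulRight v with he
  have hB4 : B ^ 3 ≤ B ^ 4 := pow_le_pow_right₀ hB (by norm_num)
  have hB0 : 1 ≤ B ^ 4 := one_le_pow₀ hB
  have hB3δ : B ^ 3 * δ ≤ B ^ 4 * δ := by gcongr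
  have hB4δ : δ ≤ B ^ 4 * δ := by nlinarith
  have hδ' : 20 * B ^ 3 * δ ≤ 1 := by nlinarith
  have hgx : ∀ x, c • g x = φ x • v + e x := by
    intro x; simp [he]
  obtain ⟨w, k, hφw, hwv, hk, hkw⟩ := exists_eigenvector_near hB hφv hv hφ hg hδ'
  -- In the dual space the transposed projection is `ξ ↦ ξ(v) φ`: evaluation at `v` plays the role
  -- of the functional and `φ` that of the vector.
  let ev : (Euc d →L[ℝ] ℝ) →L[ℝ] ℝ := ContinuousLinearMap.apply ℝ ℝ v
  let e' : (Euc d →L[ℝ] ℝ) →L[ℝ] (Euc d →L[ℝ] ℝ) := (ContinuousLinearMap.compL ℝ _ _ ℝ).flip e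
  have hev : ‖ev‖ ≤ B :=
    ContinuousLinearMap.opNorm_le_bound _ (by linarith) fun ξ =>
      (ξ.le_opNorm v).trans (by rw [mul_comm]; gcongr)
  have he' : ‖e'‖ ≤ δ :=
    ContinuousLinearMap.opNorm_le_bound _ hδ0 fun ξ =>
      (ξ.opNorm_comp_le e).trans (by rw [mul_comm]; gcongr)
  obtain ⟨ξ, k', hξv, hξφ, hk', hkξ⟩ := exists_eigenvector_near (f := ev) hB hφv hφ hev he' hδ'
  change ξ v = 1 at hξv
  have hkξx : ∀ x, φ x + ξ (e x) = k' * ξ x := fun x => by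
    exact congrArg (fun ζ : Euc d →L[ℝ] ℝ => ζ x) hkξ
  have hwn : ‖w‖ ≤ 2 * B := by
    have : ‖w‖ ≤ ‖w - v‖ + ‖v‖ := by simpa using norm_add_le (w - v) v
    linarith
  have hξn : ‖ξ‖ ≤ 2 * B := by
    have : ‖ξ‖ ≤ ‖ξ - φ‖ + ‖φ‖ := by simpa using norm_add_le (ξ - φ) φ
    linarith
  have hξw : 1 / 2 ≤ ξ w := by
    have h1 := (ξ - φ).le_opNorm w
    have h2 : ‖ξ - φ‖ * ‖w‖ ≤ 8 * B ^ 3 * δ * (2 * B) := by gcongr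
    rw [sub_apply, hφw, Real.norm_eq_abs] at h1
    have := (abs_le.1 (h1.trans h2)).1
    nlinarith
  have hξw0 : 0 < ξ w := by linarith
  have hcw : c • g w = k • w := by rw [hgx, hφw, one_smul, hkw]
  have hcξ : ∀ x, c * ξ (g x) = k' * ξ x := by
    intro x
    rw [← smul_eq_mul, ← map_smul, hgx, map_add, map_smul, hξv, smul_eq_mul, mul_one, hkξx]
  -- The left and right eigenvalues coincide because the eigenvectors pair nontrivially.
  have hkk : k' = k := by
    have h1 := hcξ w
    rw [← smul_eq_mul, ← map_smul, hcw, map_smul, smul_eq_mul] at h1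
    exact (mul_right_cancel₀ hξw0.ne' h1).symm
  subst hkk
  have hc : c ≠ 0 := by
    rintro rfl
    rw [zero_smul, eq_comm, smul_eq_zero] at hcw
    rcases hcw with h | h
    · linarith
    · rw [h, map_zero] at hξw; linarith
  have hc' : 0 < |c| := abs_pos.2 hc
  refine ⟨k' / c, w, (ξ w)⁻¹ • ξ, ⟨?_, by positivity, by linarith, ?_, ?_, ?_, ?_⟩, ?_⟩
  · exact div_ne_zero (by linarith) hc
  · simp [hξw0.ne']
  · rw [div_eq_inv_mul, mul_smul, ← hcw, inv_smul_smul₀ hc]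
  · intro x
    simp only [smul_apply, smul_eq_mul]
    have := hcξ x
    field_simp
    linear_combination this
  · intro x hx
    have hx0 : ξ x = 0 := by
      simpa [hξw0.ne'] using hx
    have h1 : |φ x| ≤ 8 * B ^ 3 * δ * ‖x‖ := by
      have := (ξ - φ).le_opNorm x
      rw [sub_apply, hx0, zero_sub, norm_neg, Real.norm_eq_abs] at this
      exact this.trans (by gcongr)
    have h2 : |c| * ‖g x‖ ≤ 9 * B ^ 4 * δ * ‖x‖ := by
      rw [← Real.norm_eq_abs, ← norm_smul, hgx]
      calc ‖φ x • v + e x‖ ≤ |φ x| * ‖v‖ + ‖e‖ * ‖x‖ := by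
            refine (norm_add_le _ _).trans (add_le_add ?_ (e.le_opNorm x))
            rw [norm_smul, Real.norm_eq_abs]
        _ ≤ 8 * B ^ 3 * δ * ‖x‖ * B + B ^ 4 * δ * ‖x‖ := by
            gcongr; exact hg.trans hB4δ
        _ = _ := by ring
    rw [abs_div, abs_of_pos (by linarith : 0 < k')]
    rw [div_mul_eq_mul_div, div_mul_eq_mul_div, le_div_iff₀ hc']
    have h3 : 0 ≤ B ^ 4 * δ * ‖x‖ := by positivity
    nlinarith
  · rw [norm_smul, norm_inv, Real.norm_eq_abs, abs_of_pos hξw0]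
    have : (ξ w)⁻¹ ≤ 2 := inv_le_of_inv_le₀ (by norm_num) (by linarith)
    calc ‖w‖ * ((ξ w)⁻¹ * ‖ξ‖) ≤ 2 * B * (2 * (2 * B)) := by gcongr
      _ = _ := by ring

/-- Multiples of maps close to a given projection of rank one are `τ`-proximal. -/
lemma exists_isEpsProximal_of_near {v : Euc d} {φ : Euc d →L[ℝ] ℝ} (hφv : φ v = 1) :
    ∃ τ₀ : ℝ, 0 < τ₀ ∧ ∀ τ : ℝ, 0 < τ → τ < τ₀ → ∃ δ : ℝ, 0 < δ ∧ ∀ (g : GLd d) (c : ℝ),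
      ‖c • g.toOp - φ.smulRight v‖ ≤ δ → IsEpsProximal τ g := by
  obtain ⟨B, hB⟩ : ∃ B, B = 1 + ‖v‖ + ‖φ‖ := ⟨_, rfl⟩
  have hv := norm_nonneg v
  have hφ := norm_nonneg φ
  have hB1 : 1 ≤ B := by linarith
  -- The perturbed pair satisfies `‖w‖ ‖ξ‖ ≤ 8 B²`, and the separation condition `2 τ (8 B²) ≤ 1`
  -- fixes the threshold.
  refine ⟨1 / (16 * B ^ 2), by positivity, fun τ hτ hτ0 => ?_⟩
  set δ₁ : ℝ := τ ^ 3 / (2 * Real.pi ^ 3 * (8 * B ^ 2) ^ 2) / (18 * B ^ 4) with hδ₁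
  have hπ := Real.pi_pos
  refine ⟨min (1 / (32 * B ^ 4)) δ₁, by positivity, fun g c hg => ?_⟩
  have hδ : 32 * B ^ 4 * min (1 / (32 * B ^ 4)) δ₁ ≤ 1 := by
    calc _ ≤ 32 * B ^ 4 * (1 / (32 * B ^ 4)) := by gcongr; exact min_le_left _ _
      _ = 1 := by field_simp
  obtain ⟨μ, w, ξ, h, hβ⟩ :=
    exists_isDominated_of_near hB1 hφv (by linarith) (by linarith) hδ hg
  refine h.isEpsProximal hτ hβ ?_ ?_
  · rw [lt_div_iff₀ (by positivity)] at hτ0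
    linarith
  · calc _ ≤ 18 * B ^ 4 * δ₁ := by gcongr; exact min_le_right _ _
      _ = _ := by rw [hδ₁]; field_simp

end Perturbation

/-! ### Pinching and twisting -/

section Twisting

variable {d : ℕ}

/-- The uniform consequence of pinching and twisting: `P ^ m`, normalized, tends to a projection of
rank one `x ↦ φ x • u`, and each operator `G` has a matrix coefficient of size comparable to `‖G‖`
along finitely many vectors `P ^ l (ψ u)` and covectors `φ ∘ ψ ∘ P ^ l'`. -/
lemma exists_dominant_pairing (hd : 1 ≤ d) {P : GLd d} {v : Fin d → Euc d}
    (hP : IsPinchingEigenbasis P v) {ψ : Euc d →L[ℝ] Euc d}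
    (hψ : ∀ I J : Finset (Fin d), I.card + J.card ≤ d →
      LinearIndependent ℝ (Sum.elim (fun i : I => ψ (v i)) (fun j : J => v j))) :
    ∃ (u : Euc d) (φ : Euc d →L[ℝ] ℝ) (t : ℝ), φ u = 1 ∧ t ≠ 0 ∧
      Tendsto (fun m : ℕ => (t ^ m)⁻¹ • P.toOp ^ m) atTop (𝓝 (φ.smulRight u)) ∧
      ∃ c : ℝ, 0 < c ∧ ∀ G : Euc d →L[ℝ] Euc d, ∃ l < d, ∃ l' < d,
        c * ‖G‖ ≤ |φ ((ψ * P.toOp ^ l' * G * P.toOp ^ l * ψ) u)| := by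
  have : Nonempty (Fin d) := ⟨⟨0, hd⟩⟩
  obtain ⟨l, hl, hv⟩ := hP
  have hlinj : Function.Injective l := fun i j h => hl (by simp [h])
  have hind : LinearIndependent ℝ v := by
    refine Module.End.eigenvectors_linearIndependent' (P.toOp : Euc d →ₗ[ℝ] Euc d) l hlinj v
      fun i => ⟨Module.End.mem_eigenspace_iff.2 (hv i).2, (hv i).1⟩
  let b := basisOfLinearIndependentOfCardEqFinrank hind (by simp)
  have hb : ∀ i, b i = v i := fun i => by simp [b]
  have hl0 : ∀ i, l i ≠ 0 := by
    intro i h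
    have := (hv i).2
    rw [h, zero_smul, map_eq_zero_iff P P.injective] at this
    exact (hv i).1 this
  let φ : Fin d → Euc d →L[ℝ] ℝ := fun i => LinearMap.toContinuousLinearMap (b.coord i)
  have hφ : ∀ i x, φ i x = b.repr x i := fun i x => rfl
  have hφv : ∀ i j, φ i (v j) = if j = i then 1 else 0 := by
    intro i j
    rw [hφ, ← hb, b.repr_self, Finsupp.single_apply]
  have hext : ∀ x, (∀ i, φ i x = 0) → x = 0 := by
    intro x hx
    exact b.ext_elem fun i => by rw [← hφ, hx]; simp
  have hsum : ∀ x, x = ∑ i, φ i x • v i := by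
    intro x
    conv_lhs => rw [← b.sum_repr x]
    exact Finset.sum_congr rfl fun i _ => by rw [hb]; rfl
  have hPv : ∀ (m : ℕ) i, (P.toOp ^ m) (v i) = l i ^ m • v i := by
    intro m i
    induction m with
    | zero => simp
    | succ m ih =>
      have h1 : P.toOp (v i) = l i • v i := (hv i).2
      rw [pow_succ', mul_apply_eq_comp, ih, map_smul, h1, smul_smul, pow_succ]
  have hφP : ∀ (m : ℕ) i x, φ i ((P.toOp ^ m) x) = l i ^ m * φ i x := by
    intro m i x
    conv_lhs => rw [hsum x]
    simp [hPv, hφv, mul_comm]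
  -- Twisting is used only with `|I| = 1` and `|J| = d - 1`: a vanishing `j`-th coordinate would put
  -- `ψ (v i)` in the span of the other eigenvectors.
  have hψv : ∀ i j, φ j (ψ (v i)) ≠ 0 := by
    intro i j h
    have hli := hψ {i} (Finset.univ.erase j) (by
      rw [Finset.card_singleton, Finset.card_erase_of_mem (Finset.mem_univ _), Finset.card_univ,
        Fintype.card_fin]
      omega)
    have hnot := (linearIndependent_iff_notMem_span.1 hli) (Sum.inl ⟨i, by simp⟩)
    refine hnot ?_
    simp only [Sum.elim_inl]
    rw [hsum (ψ (v i))]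
    refine Submodule.sum_mem _ fun k _ => ?_
    by_cases hk : k = j
    · rw [hk, h, zero_smul]; exact Submodule.zero_mem _
    · refine Submodule.smul_mem _ _ (Submodule.subset_span
        ⟨Sum.inr ⟨k, by simp [hk]⟩, by simp, rfl⟩)
  obtain ⟨i₀, -, hi₀⟩ := Finset.exists_max_image Finset.univ (fun i => |l i|)
    Finset.univ_nonempty
  have hlt : ∀ j, j ≠ i₀ → |l j / l i₀| < 1 := by
    intro j hj
    rw [abs_div, div_lt_one (abs_pos.2 (hl0 _))]
    exact lt_of_le_of_ne (hi₀ j (Finset.mem_univ _)) fun h => hj (hl h)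
  refine ⟨v i₀, φ i₀, l i₀, by simp [hφv], hl0 i₀, ?_, ?_⟩
  · have h1 : ∀ m : ℕ, (l i₀ ^ m)⁻¹ • P.toOp ^ m =
        ∑ j, (l j / l i₀) ^ m • (φ j).smulRight (v j) := by
      intro m
      ext1 x
      conv_lhs => rw [hsum x]
      simp only [smul_apply, map_sum, map_smul, hPv, sum_apply,
        ContinuousLinearMap.smulRight_apply, smul_smul]
      refine Finset.sum_congr rfl fun j _ => ?_
      rw [div_pow]; congr 1; ring
    have h2 : (φ i₀).smulRight (v i₀) =
        ∑ j, (if j = i₀ then (1 : ℝ) else 0) • (φ j).smulRight (v j) := by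
      rw [Finset.sum_eq_single i₀, if_pos rfl]
      · exact (one_smul ℝ _).symm
      · intro j _ hj
        rw [if_neg hj]
        ext1 x
        exact zero_smul ℝ (φ j x • v j)
      · simp
    simp_rw [h1]
    rw [h2]
    refine tendsto_finsetSum _ fun j _ => ?_
    have h3 : Tendsto (fun m : ℕ => (l j / l i₀) ^ m) atTop (𝓝 (if j = i₀ then 1 else 0)) := by
      split_ifs with hj
      · rw [hj, div_self (hl0 _)]
        simp only [one_pow]
        exact tendsto_const_nhds
      · exact tendsto_pow_atTop_nhds_zero_of_abs_lt_one (hlt j hj)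
    exact h3.smul_const _
  -- An injective linear map on a finite-dimensional space is bounded below, so injectivity of this
  -- family of coefficients yields the uniform constant `c`.
  · let Φ : (Euc d →L[ℝ] Euc d) →ₗ[ℝ] (Fin d × Fin d → ℝ) :=
      { toFun := fun G q => φ i₀ ((ψ * P.toOp ^ q.2.1 * G * P.toOp ^ q.1.1 * ψ) (v i₀))
        map_add' := fun G G' => by
          funext q
          change φ i₀ (ψ ((P.toOp ^ q.2.1) (G ((P.toOp ^ q.1.1) (ψ (v i₀))) +
            G' ((P.toOp ^ q.1.1) (ψ (v i₀)))))) =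
            φ i₀ (ψ ((P.toOp ^ q.2.1) (G ((P.toOp ^ q.1.1) (ψ (v i₀)))))) +
            φ i₀ (ψ ((P.toOp ^ q.2.1) (G' ((P.toOp ^ q.1.1) (ψ (v i₀))))))
          simp only [map_add]
        map_smul' := fun t G => by
          funext q
          change φ i₀ (ψ ((P.toOp ^ q.2.1) (t • G ((P.toOp ^ q.1.1) (ψ (v i₀)))))) =
            t * φ i₀ (ψ ((P.toOp ^ q.2.1) (G ((P.toOp ^ q.1.1) (ψ (v i₀))))))
          simp only [map_smul, smul_eq_mul] }
    have hker : LinearMap.ker Φ = ⊥ := by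
      rw [LinearMap.ker_eq_bot']
      intro G hG
      have hy : ∀ k : Fin d, G ((P.toOp ^ k.1) (ψ (v i₀))) = 0 := by
        intro k
        refine hext _ fun j => ?_
        -- Vandermonde for the distinct eigenvalues, with `l' = 0, …, d - 1`; the factor `φ i₀ (ψ (v
        -- j))` is then cancelled since it is nonzero. The same argument in `l` follows for `G (v
        -- k)`.
        have h0 := Matrix.eq_zero_of_forall_pow_sum_mul_pow_eq_zero (f := l)
          (v := fun j => φ i₀ (ψ (v j)) *
            φ j (G ((P.toOp ^ k.1) (ψ (v i₀))))) hlinj (fun k' => by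
            have h1 : φ i₀ (ψ ((P.toOp ^ k'.1) (G ((P.toOp ^ k.1) (ψ (v i₀)))))) = 0 :=
              congrFun hG (k, k')
            rw [hsum ((P.toOp ^ k'.1) _)] at h1
            simp only [map_sum, map_smul, smul_eq_mul, hφP] at h1
            rw [← h1]
            exact Finset.sum_congr rfl fun j _ => by ring)
        have h2 := congrFun h0 j
        simpa [hψv] using h2
      have hGv : ∀ k j, φ j (G (v k)) = 0 := by
        intro k j
        have h0 := Matrix.eq_zero_of_forall_pow_sum_mul_pow_eq_zero (f := l)
          (v := fun k => φ k (ψ (v i₀)) * φ j (G (v k))) hlinj (fun k' => by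
            have h1 := congrArg (φ j) (hy k')
            rw [hsum ((P.toOp ^ k'.1) _), map_zero] at h1
            simp only [map_sum, map_smul, smul_eq_mul, hφP] at h1
            rw [← h1]
            exact Finset.sum_congr rfl fun j _ => by ring)
        have h2 := congrFun h0 k
        simpa [hψv] using h2
      ext1 x
      rw [hsum x, map_sum]
      exact Finset.sum_eq_zero fun k _ => by rw [map_smul, hext _ (hGv k), smul_zero]
    obtain ⟨K, hK, hanti⟩ := LinearMap.exists_antilipschitzWith Φ hker
    have hK' : (0 : ℝ) < K := hK
    refine ⟨(K : ℝ)⁻¹, by positivity, fun G => ?_⟩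
    by_contra hcon
    push Not at hcon
    have hlt : ∀ q : Fin d × Fin d, ‖Φ G q‖ < (K : ℝ)⁻¹ * ‖G‖ := fun q =>
      hcon q.1.1 q.1.2 q.2.1 q.2.2
    obtain ⟨i⟩ := ‹Nonempty (Fin d)›
    have hpos := (norm_nonneg _).trans_lt (hlt (i, i))
    have h1 := (pi_norm_lt_iff hpos).2 hlt
    have h2 : ‖G‖ ≤ K * ‖Φ G‖ := by
      simpa using hanti.le_mul_dist G 0
    have h3 : K * ‖Φ G‖ < ‖G‖ := by
      calc K * ‖Φ G‖ < K * ((K : ℝ)⁻¹ * ‖G‖) := by gcongr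
        _ = ‖G‖ := by field_simp
    linarith

end Twisting

/-! ### Products along shadowing segments -/

section Segments

variable {N : ℕ} {T : Matrix (Fin N) (Fin N) ℕ} {d : ℕ} {A : Subshift T → GLd d} {ρ η C : ℝ}

/-- The stable half of the holonomy loop, truncated at time `n`. -/
def stableTrunc (A : Subshift T → GLd d) (p z : Subshift T) (n : ℕ) : Euc d →L[ℝ] Euc d :=
  ((iter A n p)⁻¹ * iter A n z).toOp

/-- The unstable half of the holonomy loop, truncated at time `-n`. -/
def unstableTrunc (A : Subshift T → GLd d) (p z : Subshift T) (n : ℕ) : Euc d →L[ℝ] Euc d :=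
  (iter A n ((shift ^ (-(n : ℤ))) z) * (iter A n ((shift ^ (-(n : ℤ))) p))⁻¹).toOp

lemma shift_pow_shift_neg_pow (x : Subshift T) (n : ℕ) :
    (shift ^ n) ((shift ^ (-(n : ℤ))) x) = x := by
  rw [← zpow_natCast, shift_zpow_add, add_neg_cancel, zpow_zero, Equiv.Perm.one_apply]

lemma shift_neg_pow_eq {p : Subshift T} {n : ℕ} (h : (shift ^ n) p = p) :
    (shift ^ (-(n : ℤ))) p = p := by
  conv_lhs => rw [← h]
  rw [← zpow_natCast, shift_zpow_add, neg_add_cancel, zpow_zero, Equiv.Perm.one_apply]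

lemma shift_pow_mul_eq {p : Subshift T} {π : ℕ} (h : (shift ^ π) p = p) (m : ℕ) :
    (shift ^ (m * π)) p = p := by
  induction m with
  | zero => simp
  | succ m ih => rw [Nat.succ_mul, pow_add, Equiv.Perm.mul_apply, h, ih]

/-- An exact identity: each truncated holonomy is a quotient of a product along `z` by a power of
`P`, and the powers are multiplied back. -/
lemma iter_loop {π : ℕ} {p : Subshift T} (hp : (shift ^ π) p = p) (z : Subshift T) (k m : ℕ) :
    (iter A (k * π + m * π) ((shift ^ (-((m * π : ℕ) : ℤ))) z)).toOp =
      (iter A π p).toOp ^ k * (stableTrunc A p z (k * π) * unstableTrunc A p z (m * π)) *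
        (iter A π p).toOp ^ m := by
  rw [iter_add, shift_pow_shift_neg_pow, stableTrunc, unstableTrunc,
    shift_neg_pow_eq (shift_pow_mul_eq hp m), iter_periodic A hp, iter_periodic A hp,
    ← toOp_pow, ← toOp_pow, ← toOp_mul, ← toOp_mul, ← toOp_mul]
  congr 1
  group

namespace UniformlyBunched

/-- Here `F = P^(-s) E P^s`; bunching makes the conjugation harmless when `E` is already of size
`ρ^(s π)`. -/
lemma absorb_right (hA : UniformlyBunched A ρ η C) {π : ℕ} {p : Subshift T}
    (hp : (shift ^ π) p = p) {s : ℕ} {κ : ℝ} (hκ : 0 ≤ κ) {E : Euc d →L[ℝ] Euc d}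
    (hE : ‖E‖ ≤ κ * ρ ^ (s * π)) :
    ∃ F : Euc d →L[ℝ] Euc d, ‖F‖ ≤ κ * η ^ (s * π) ∧
      (1 + E) * (iter A π p).toOp ^ s = (iter A π p).toOp ^ s * (1 + F) := by
  refine ⟨_, (hA.norm_conj_le (x := p) hκ hE).1, ?_⟩
  rw [iter_periodic A hp, ← toOp_pow]
  have h := toOp_mul_inv (iter A π p ^ s)
  rw [mul_add, ← mul_assoc, ← mul_assoc, h, one_mul, add_mul, one_mul, mul_one]

lemma absorb_left (hA : UniformlyBunched A ρ η C) {π : ℕ} {p : Subshift T}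
    (hp : (shift ^ π) p = p) {s : ℕ} {κ : ℝ} (hκ : 0 ≤ κ) {E : Euc d →L[ℝ] Euc d}
    (hE : ‖E‖ ≤ κ * ρ ^ (s * π)) :
    ∃ F : Euc d →L[ℝ] Euc d, ‖F‖ ≤ κ * η ^ (s * π) ∧
      (iter A π p).toOp ^ s * (1 + E) = (1 + F) * (iter A π p).toOp ^ s := by
  refine ⟨_, (hA.norm_conj_le (x := p) hκ hE).2, ?_⟩
  rw [iter_periodic A hp, ← toOp_pow]
  have h := toOp_inv_mul (iter A π p ^ s)
  rw [add_mul, mul_assoc (_ * E), h, one_mul, mul_add, mul_one, mul_one]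

/-- The late error is moved behind `P^s`, which frees that power to absorb the error of the
excursion as well. The early error `E` stays next to `P^m`, which is bounded after normalization. -/
lemma segment_out (hA : UniformlyBunched A ρ η C) {π : ℕ} {p z : Subshift T}
    (hp : (shift ^ π) p = p) {r s m l : ℕ} {q : Subshift T}
    (hr : r ≤ m * π)
    (hq : ∀ i : ℤ, -((m * π : ℕ) - r : ℤ) ≤ i →
      i ≤ (m * π : ℕ) + ((s + l) * π : ℕ) + (s * π : ℕ) → q.1 i = z.1 (i - (m * π : ℕ))) :
    ∃ E F : Euc d →L[ℝ] Euc d, ‖E‖ ≤ distConst η C * ρ ^ (m * π - r) ∧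
      ‖F‖ ≤ distConst η C * η ^ (s * π) ∧
      (iter A ((s + l) * π + m * π) q).toOp = (iter A π p).toOp ^ s * (1 + F) *
        (iter A π p).toOp ^ l * (stableTrunc A p z ((s + l) * π) * unstableTrunc A p z (m * π)) *
        (iter A π p).toOp ^ m * (1 + E) := by
  have hsl : (s + l) * π = s * π + l * π := by ring
  obtain ⟨E, E', hE, hE', h⟩ := hA.distortion (a := m * π - r) (b := s * π)
    (n := (s + l) * π + m * π) (x := (shift ^ (-((m * π : ℕ) : ℤ))) z) (y := q)
    (by omega) (by omega) (fun i h1 h2 => by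
      rw [shift_neg_pow_apply]
      exact (hq i (by omega) (by omega)).symm)
  obtain ⟨F, hF, hF'⟩ := hA.absorb_right hp hA.distConst_nonneg hE'
  refine ⟨E, F, hE, hF, ?_⟩
  rw [h, iter_loop hp, pow_add, ← hF']
  simp only [mul_assoc]

lemma segment_in (hA : UniformlyBunched A ρ η C) {π : ℕ} {p z : Subshift T}
    (hp : (shift ^ π) p = p) {r s m l : ℕ} {q : Subshift T}
    (hr : r ≤ m * π)
    (hq : ∀ i : ℤ, -((s * π : ℕ) : ℤ) ≤ i →
      i ≤ ((s + l) * π : ℕ) + (m * π : ℕ) + ((m * π : ℕ) - r) →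
      q.1 i = z.1 (i - ((s + l) * π : ℕ))) :
    ∃ E F : Euc d →L[ℝ] Euc d, ‖E‖ ≤ distConst η C * ρ ^ (m * π - r) ∧
      ‖F‖ ≤ distConst η C * η ^ (s * π) ∧
      (iter A (m * π + (s + l) * π) q).toOp = (1 + E) * (iter A π p).toOp ^ m *
        (stableTrunc A p z (m * π) * unstableTrunc A p z ((s + l) * π)) *
        (iter A π p).toOp ^ l * (1 + F) * (iter A π p).toOp ^ s := by
  have hsl : (s + l) * π = s * π + l * π := by ring
  obtain ⟨E', E, hE', hE, h⟩ := hA.distortion (a := s * π) (b := m * π - r)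
    (n := m * π + (s + l) * π) (x := (shift ^ (-(((s + l) * π : ℕ) : ℤ))) z) (y := q)
    (by omega) (by omega) (fun i h1 h2 => by
      rw [shift_neg_pow_apply]
      exact (hq i (by omega) (by omega)).symm)
  obtain ⟨F, hF, hF'⟩ := hA.absorb_left hp hA.distConst_nonneg hE'
  refine ⟨E, F, hE, hF, ?_⟩
  rw [h, iter_loop hp, add_comm s l, pow_add, mul_assoc _ (1 + F), ← hF']
  simp only [mul_assoc]

/-- Both errors are pushed outside the powers `P^s`, so the operator left in the middle depends only
on `x`. The exponents `l`, `l'` can thus be chosen from it before `q` is built. -/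
lemma segment_through (hA : UniformlyBunched A ρ η C) {π : ℕ} {p : Subshift T}
    (hp : (shift ^ π) p = p) {r s n : ℕ} {x q : Subshift T}
    (hq : ∀ i : ℤ, -((s * π - r : ℕ) : ℤ) ≤ i → i ≤ n + (s * π - r : ℕ) → x.1 i = q.1 i) :
    ∃ F F' : Euc d →L[ℝ] Euc d, ‖F‖ ≤ distConst η C * (ρ ^ r)⁻¹ * η ^ (s * π) ∧
      ‖F'‖ ≤ distConst η C * (ρ ^ r)⁻¹ * η ^ (s * π) ∧
      (iter A π p).toOp ^ s * (iter A n q).toOp * (iter A π p).toOp ^ s =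
        (1 + F') * ((iter A π p).toOp ^ s * (iter A n x).toOp * (iter A π p).toOp ^ s) *
          (1 + F) := by
  have hρ := hA.rho_pos
  have hD := hA.distConst_nonneg
  obtain ⟨E, E', hE, hE', h⟩ := hA.distortion (n := n) (by omega) (by omega) hq
  have hb : distConst η C * ρ ^ (s * π - r) ≤ distConst η C * (ρ ^ r)⁻¹ * ρ ^ (s * π) := by
    rw [mul_assoc]
    exact mul_le_mul_of_nonneg_left (hA.rho_pow_sub_le _ _) hD
  obtain ⟨F, hF, hF1⟩ := hA.absorb_right hp (by positivity) (hE.trans hb)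
  obtain ⟨F', hF', hF1'⟩ := hA.absorb_left hp (by positivity) (hE'.trans hb)
  refine ⟨F, F', hF, hF', ?_⟩
  rw [h]
  simp only [mul_assoc]
  rw [hF1, ← mul_assoc _ (1 + E'), hF1']
  simp only [mul_assoc]

end UniformlyBunched
end Segments

/-! ### Stability of the product around the middle operator. -/

section Limit

variable {d : ℕ}

lemma norm_mul_sub_mul_le {R : Type*} [NormedRing R] {X X₀ Y Y₀ : R} {K K' a b : ℝ}
    (hX : ‖X - X₀‖ ≤ a) (hY : ‖Y - Y₀‖ ≤ b) (hX₀ : ‖X₀‖ ≤ K) (hY₀ : ‖Y₀‖ ≤ K') :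
    ‖X * Y - X₀ * Y₀‖ ≤ a * (K' + b) + K * b := by
  have e : X * Y - X₀ * Y₀ = (X - X₀) * Y + X₀ * (Y - Y₀) := by noncomm_ring
  have hYn : ‖Y‖ ≤ K' + b := by
    have : ‖Y‖ ≤ ‖Y₀‖ + ‖Y - Y₀‖ := by simpa using norm_add_le Y₀ (Y - Y₀)
    linarith
  have ha : 0 ≤ a := (norm_nonneg _).trans hX
  have hK : 0 ≤ K := (norm_nonneg _).trans hX₀
  rw [e]
  refine (norm_add_le _ _).trans (add_le_add ((norm_mul_le _ _).trans ?_)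
    ((norm_mul_le _ _).trans ?_)) <;> gcongr

lemma norm_chain_left_le {R : Type*} [NormedRing R] {L Q Y ψ Z e : R} {K ε : ℝ}
    (n1 : ‖(1 : R)‖ ≤ 1) (hK : 1 ≤ K) (hε : ε ≤ 1) (hL : ‖L - Q‖ ≤ ε) (hY : ‖Y - ψ‖ ≤ ε)
    (he : ‖e - 1‖ ≤ ε) (hQ : ‖Q‖ ≤ K) (hψ : ‖ψ‖ ≤ K) (hZ : ‖Z‖ ≤ K) :
    ‖L * Y * Z * e - Q * ψ * Z‖ ≤ 7 * K ^ 3 * ε := by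
  have hε0 : 0 ≤ ε := (norm_nonneg _).trans hL
  have b2 : ‖Q * ψ‖ ≤ K * K := (norm_mul_le _ _).trans (by gcongr)
  have b3 : ‖Q * ψ * Z‖ ≤ K * K * K := (norm_mul_le _ _).trans (by gcongr)
  have h1 := norm_mul_sub_mul_le hL hY hQ hψ
  have h2 := norm_mul_sub_mul_le h1 (show ‖Z - Z‖ ≤ 0 by simp) b2 hZ
  have h3 := norm_mul_sub_mul_le h2 he b3 n1
  rw [mul_one] at h3
  refine h3.trans ?_
  have k1 : ε * (K + ε) + K * ε ≤ 3 * K * ε := by nlinarith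
  have k2 : K ^ 2 * ε ≤ K ^ 3 * ε := by gcongr; norm_num
  calc _ ≤ (3 * K * ε * (K + 0) + K * K * 0) * (1 + 1) + K * K * K * ε := by gcongr
    _ = 6 * (K ^ 2 * ε) + K ^ 3 * ε := by ring
    _ ≤ _ := by linarith

lemma norm_inv_smul_sub_le {E : Type*} [NormedAddCommGroup E] [NormedSpace ℝ E] {f δ : ℝ}
    {X Q : E} (hf : f ≠ 0) (h : ‖X - f • Q‖ ≤ |f| * δ) : ‖f⁻¹ • X - Q‖ ≤ δ := by
  have e : f⁻¹ • X - Q = f⁻¹ • (X - f • Q) := by rw [smul_sub, inv_smul_smul₀ hf]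
  rw [e, norm_smul, norm_inv, Real.norm_eq_abs, inv_mul_le_iff₀ (abs_pos.2 hf)]
  exact h

/-- The opposite ring reverses products and keeps norms, so this is `norm_chain_left_le` read
backwards. -/
lemma norm_chain_right_le {R : Type*} [NormedRing R] {L Q Y ψ Z e : R} {K ε : ℝ}
    (n1 : ‖(1 : R)‖ ≤ 1) (hK : 1 ≤ K) (hε : ε ≤ 1) (hL : ‖L - Q‖ ≤ ε) (hY : ‖Y - ψ‖ ≤ ε)
    (he : ‖e - 1‖ ≤ ε) (hQ : ‖Q‖ ≤ K) (hψ : ‖ψ‖ ≤ K) (hZ : ‖Z‖ ≤ K) :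
    ‖e * (Z * (Y * L)) - Z * (ψ * Q)‖ ≤ 7 * K ^ 3 * ε := by
  have h := norm_chain_left_le (R := Rᵐᵒᵖ) (L := .op L) (Q := .op Q) (Y := .op Y) (ψ := .op ψ)
    (Z := .op Z) (e := .op e) n1 hK hε hL hY he hQ hψ hZ
  exact h

lemma smulRight_conj (ψ G Z Z' : Euc d →L[ℝ] Euc d) (u : Euc d) (φ : Euc d →L[ℝ] ℝ) :
    (φ.smulRight u * ψ * Z' * G) * (Z * (ψ * φ.smulRight u)) =
      φ ((ψ * Z' * G * Z * ψ) u) • φ.smulRight u := by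
  ext1 x
  change φ (ψ (Z' (G (Z (ψ (φ x • u)))))) • u = φ (ψ (Z' (G (Z (ψ u))))) • (φ x • u)
  simp only [map_smul, smul_smul, smul_eq_mul]
  rw [mul_comm]

/-- The product of operators near `Q`, `ψ`, powers of `P` and the identity, with one arbitrary
operator `G` in the middle, is near a multiple of the projection `Q = φ ⊗ u`. -/
lemma exists_near_projection {P ψ : Euc d →L[ℝ] Euc d} {u : Euc d} {φ : Euc d →L[ℝ] ℝ} {c : ℝ}
    (hc : 0 < c) (hG : ∀ G : Euc d →L[ℝ] Euc d, ∃ l < d, ∃ l' < d,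
        c * ‖G‖ ≤ |φ ((ψ * P ^ l' * G * P ^ l * ψ) u)|) {δ : ℝ} (hδ : 0 < δ) :
    ∃ ε : ℝ, 0 < ε ∧ ∀ G : Euc d →L[ℝ] Euc d, G ≠ 0 → ∃ l < d, ∃ l' < d,
      ∀ L R Y Y' e e' : Euc d →L[ℝ] Euc d,
        ‖L - φ.smulRight u‖ ≤ ε → ‖R - φ.smulRight u‖ ≤ ε → ‖Y - ψ‖ ≤ ε → ‖Y' - ψ‖ ≤ ε →
        ‖e - 1‖ ≤ ε → ‖e' - 1‖ ≤ ε →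
        ∃ t : ℝ, ‖t • ((L * Y' * P ^ l' * e') * G * (e * (P ^ l * (Y * R)))) -
          φ.smulRight u‖ ≤ δ := by
  set Q := φ.smulRight u with hQ
  obtain ⟨K, hK⟩ : ∃ K, K = 1 + ‖Q‖ + ‖ψ‖ + ∑ l ∈ Finset.range d, ‖P ^ l‖ := ⟨_, rfl⟩
  have hS : 0 ≤ ∑ l ∈ Finset.range d, ‖P ^ l‖ := Finset.sum_nonneg fun _ _ => norm_nonneg _
  have hQn := norm_nonneg Q
  have hψn := norm_nonneg ψ
  have hK1 : 1 ≤ K := by linarith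
  have hKQ : ‖Q‖ ≤ K := by linarith
  have hKψ : ‖ψ‖ ≤ K := by linarith
  have hKP : ∀ l < d, ‖P ^ l‖ ≤ K := by
    intro l hl
    have : ‖P ^ l‖ ≤ ∑ l ∈ Finset.range d, ‖P ^ l‖ :=
      Finset.single_le_sum (f := fun l => ‖P ^ l‖) (fun _ _ => norm_nonneg _)
        (Finset.mem_range.2 hl)
    linarith
  have hK2 : K ≤ K ^ 2 := by nlinarith
  have hK3 : K ^ 2 ≤ K ^ 3 := by nlinarith [sq_nonneg K]
  have hK6 : K ^ 3 ≤ K ^ 6 := pow_le_pow_right₀ hK1 (by norm_num)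
  -- The total error is at most `21 K⁶ ε ‖G‖`, to be compared with `|f| δ ≥ c ‖G‖ δ`; the factor
  -- `‖G‖` cancels, so `ε` does not depend on `G`.
  set ε := min (1 / (7 * K ^ 3)) (c * δ / (21 * K ^ 6)) with hε
  have hε0 : 0 < ε := by positivity
  have hε1 : 7 * K ^ 3 * ε ≤ 1 := by
    calc _ ≤ 7 * K ^ 3 * (1 / (7 * K ^ 3)) := by gcongr; exact min_le_left _ _
      _ = 1 := by field_simp
  have hε2 : 21 * K ^ 6 * ε ≤ c * δ := by
    calc _ ≤ 21 * K ^ 6 * (c * δ / (21 * K ^ 6)) := by gcongr; exact min_le_right _ _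
      _ = c * δ := by field_simp
  have hε3 : ε ≤ 1 := by nlinarith
  refine ⟨ε, hε0, fun G hG0 => ?_⟩
  obtain ⟨l, hl, l', hl', hf⟩ := hG G
  refine ⟨l, hl, l', hl', fun L R Y Y' e e' hL hR hY hY' he he' => ?_⟩
  set f := φ ((ψ * P ^ l' * G * P ^ l * ψ) u) with hfd
  have hGn : 0 < ‖G‖ := norm_pos_iff.2 hG0
  have hf0 : 0 < |f| := (mul_pos hc hGn).trans_le hf
  have n1 : ‖(1 : Euc d →L[ℝ] Euc d)‖ ≤ 1 := norm_one_le
  have hA := norm_chain_left_le n1 hK1 hε3 hL hY' he' hKQ hKψ (hKP l' hl')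
  have hB := norm_chain_right_le n1 hK1 hε3 hR hY he hKQ hKψ (hKP l hl)
  have hQGQ : (Q * ψ * P ^ l' * G) * (P ^ l * (ψ * Q)) = f • Q := smulRight_conj _ _ _ _ _ _
  have hAG : ‖L * Y' * P ^ l' * e' * G - Q * ψ * P ^ l' * G‖ ≤ 7 * K ^ 3 * ε * ‖G‖ := by
    rw [← sub_mul]
    exact (norm_mul_le _ _).trans (by gcongr)
  have hA0 : ‖Q * ψ * P ^ l' * G‖ ≤ K * K * K * ‖G‖ := by
    refine (norm_mul_le _ _).trans (mul_le_mul_of_nonneg_right ?_ (norm_nonneg _))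
    refine (norm_mul_le _ _).trans (mul_le_mul ((norm_mul_le _ _).trans ?_) (hKP l' hl')
      (norm_nonneg _) (by positivity))
    gcongr
  have hB0 : ‖P ^ l * (ψ * Q)‖ ≤ K * (K * K) := by
    refine (norm_mul_le _ _).trans (mul_le_mul (hKP l hl) ((norm_mul_le _ _).trans ?_)
      (norm_nonneg _) (by positivity))
    gcongr
  have hfin := norm_mul_sub_mul_le hAG hB hA0 hB0
  rw [hQGQ] at hfin
  have hfin' : ‖L * Y' * P ^ l' * e' * G * (e * (P ^ l * (Y * R))) - f • Q‖ ≤ c * δ * ‖G‖ := by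
    refine hfin.trans ?_
    calc _ = 7 * K ^ 3 * ε * (2 * K ^ 3 + 7 * K ^ 3 * ε) * ‖G‖ := by ring
      _ ≤ 7 * K ^ 3 * ε * (3 * K ^ 3) * ‖G‖ := by gcongr; nlinarith
      _ = 21 * K ^ 6 * ε * ‖G‖ := by ring
      _ ≤ _ := by gcongr
  refine ⟨f⁻¹, norm_inv_smul_sub_le (abs_pos.1 hf0) (hfin'.trans ?_)⟩
  calc c * δ * ‖G‖ = (c * ‖G‖) * δ := by ring
    _ ≤ |f| * δ := by gcongr

end Limit

/-! ### Choice of constants and assembly of the periodic product. -/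

section Main

lemma norm_one_add_mul_one_add_sub_one_le {R : Type*} [NormedRing R] {E F : R} {κ ε : ℝ}
    (hE : ‖E‖ ≤ κ) (hF : ‖F‖ ≤ κ) (h1 : κ ≤ 1) (hκ : 3 * κ ≤ ε) :
    ‖(1 + E) * (1 + F) - 1‖ ≤ ε := by
  have e : (1 + E) * (1 + F) - 1 = E + F + E * F := by noncomm_ring
  have h2 : ‖E * F‖ ≤ κ * 1 := (norm_mul_le _ _).trans
    (mul_le_mul hE (hF.trans h1) (norm_nonneg _) ((norm_nonneg _).trans hE))
  rw [e]
  have := norm_add_le (E + F) (E * F)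
  have := norm_add_le E F
  linarith

lemma norm_perturb_sub_le {R : Type*} [NormedRing R] {E X Q : R} {ε κ : ℝ} (hX : ‖X - Q‖ ≤ ε / 2)
    (hX1 : ‖X - Q‖ ≤ 1) (hE : ‖E‖ ≤ κ) (hκ : κ * (‖Q‖ + 1) ≤ ε / 2) :
    ‖(1 + E) * X - Q‖ ≤ ε ∧ ‖X * (1 + E) - Q‖ ≤ ε := by
  have hXn : ‖X‖ ≤ ‖Q‖ + 1 := by
    have : ‖X‖ ≤ ‖X - Q‖ + ‖Q‖ := by simpa using norm_add_le (X - Q) Q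
    linarith
  have hp : ‖E‖ * ‖X‖ ≤ ε / 2 :=
    (mul_le_mul hE hXn (norm_nonneg _) ((norm_nonneg _).trans hE)).trans hκ
  constructor
  · have e : (1 + E) * X - Q = X - Q + E * X := by noncomm_ring
    rw [e]
    linarith [norm_add_le (X - Q) (E * X), norm_mul_le E X]
  · have e : X * (1 + E) - Q = X - Q + X * E := by noncomm_ring
    rw [e]
    linarith [norm_add_le (X - Q) (X * E), norm_mul_le X E, mul_comm ‖E‖ ‖X‖]

/-- The powers `P^s` left over by the two loop segments are joined to the middle segment, and each
`P^m` receives its normalizing factor `w`. -/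
lemma smul_regroup {R : Type*} [Ring R] [Algebra ℝ R] {E₃ Pm Y' Pl' F₃ Ps S F₁ Pl Y E₁ F₂' G F₂ : R}
    (t w : ℝ) (h : Ps * S * Ps = F₂' * G * F₂) :
    (t * (w * w)) • ((E₃ * Pm * Y' * Pl' * F₃ * Ps) * (S * (Ps * F₁ * Pl * Y * Pm * E₁))) =
      t • ((E₃ * (w • Pm) * Y' * Pl' * (F₃ * F₂')) * G *
        ((F₂ * F₁) * (Pl * (Y * ((w • Pm) * E₁))))) := by
  have e : (E₃ * Pm * Y' * Pl' * F₃ * Ps) * (S * (Ps * F₁ * Pl * Y * Pm * E₁)) =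
      (E₃ * Pm * Y' * Pl' * F₃) * (Ps * S * Ps) * (F₁ * Pl * Y * Pm * E₁) := by
    simp only [mul_assoc]
  rw [e, h]
  simp only [smul_mul_assoc, mul_smul_comm, smul_smul, mul_assoc]

variable {N : ℕ} {T : Matrix (Fin N) (Fin N) ℕ} {d : ℕ}

lemma exists_agree_of_mem_homoclinicPoints {p z : Subshift T} (hz : z ∈ homoclinicPoints p) :
    ∃ r : ℕ, ∀ i : ℤ, r ≤ i.natAbs → z.1 i = p.1 i := by
  obtain ⟨⟨⟨a, ha⟩, ⟨b, hb⟩⟩, -⟩ := hz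
  refine ⟨max a b, fun i hi => ?_⟩
  rcases le_total 0 i with h | h
  · have := ha (i - a) (by omega)
    rw [shift_pow_apply, shift_pow_apply, sub_add_cancel] at this
    exact this.symm
  · have := hb (i + b) (by omega)
    rw [shift_neg_pow_apply, shift_neg_pow_apply, add_sub_cancel_right] at this
    exact this.symm

lemma UniformlyBunched.exists_near_holonomyLoop {A : Subshift T → GLd d} {ρ η C : ℝ}
    (hA : UniformlyBunched A ρ η C) {p z : Subshift T} {r : ℕ}
    (hz : ∀ i : ℤ, r ≤ i.natAbs → z.1 i = p.1 i) {ε : ℝ} (hε : 0 < ε) :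
    ∃ s₀ : ℕ, ∀ a b, s₀ ≤ a → s₀ ≤ b →
      ‖stableTrunc A p z a * unstableTrunc A p z b - holonomyLoop A p z‖ ≤ ε := by
  have hS : Tendsto (stableTrunc A p z) atTop (𝓝 (stableHolonomy A z p)) :=
    hA.tendsto_stableHolonomy (r := r) fun i hi => hz i (by omega)
  have hU : Tendsto (unstableTrunc A p z) atTop (𝓝 (unstableHolonomy A p z)) :=
    hA.tendsto_unstableHolonomy (r := r) fun i hi => (hz i (by omega)).symm
  have hSU : Tendsto (fun q : ℕ × ℕ => stableTrunc A p z q.1 * unstableTrunc A p z q.2)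
      (atTop ×ˢ atTop) (𝓝 (holonomyLoop A p z)) :=
    (hS.comp tendsto_fst).mul (hU.comp tendsto_snd)
  rw [prod_atTop_atTop_eq, Metric.tendsto_atTop] at hSU
  obtain ⟨⟨a₀, b₀⟩, h⟩ := hSU ε hε
  refine ⟨max a₀ b₀, fun a b ha hb => ?_⟩
  have := h (a, b) ⟨(le_max_left _ _).trans ha, (le_max_right _ _).trans hb⟩
  rw [dist_eq_norm] at this
  exact this.le

lemma tendsto_const_mul_pow_mul {x c : ℝ} (h0 : 0 ≤ x) (h1 : x < 1) {π : ℕ} (hπ : 0 < π) :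
    Tendsto (fun s : ℕ => c * x ^ (s * π)) atTop (𝓝 0) := by
  have h : Tendsto (fun s : ℕ => s * π) atTop atTop :=
    tendsto_atTop_mono (fun s => Nat.le_mul_of_pos_right s hπ) tendsto_id
  simpa using ((tendsto_pow_atTop_nhds_zero_of_lt_one h0 h1).comp h).const_mul c

/-- Orbit segments of a 1-typical cocycle are shadowed by periodic orbits of comparable length along
which the cocycle is `τ`-proximal. -/
theorem IsOneTypical.exists_isEpsProximal_periodic (hT : ∀ i j, T i j = 0 ∨ T i j = 1) (hprim : ∃ M : ℕ, 0 < M ∧ ∀ i j, 0 < (T ^ M) i j)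
    (hd : 1 ≤ d) {A : Subshift T → GLd d} (hA : IsOneTypical A) :
    ∃ τ₀ : ℝ, 0 < τ₀ ∧ ∀ τ : ℝ, 0 < τ → τ < τ₀ →
      ∃ k : ℕ, ∀ (x : Subshift T) (n : ℕ),
        ∃ (q : Subshift T) (nq : ℕ), 0 < nq ∧ Function.IsPeriodicPt (shift (T := T)) nq q ∧
          n ≤ nq ∧ nq ≤ n + k ∧
          IsEpsProximal τ (iter A nq q) ∧
          ∃ j : ℕ, (shift ^ j) q ∈ cylinder x n := by
  obtain ⟨hb, p, z, hper, hzh, v, hpin, htw⟩ := hA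
  obtain ⟨M, -, hM⟩ := hprim
  have : Nonempty (Subshift T) := ⟨p⟩
  obtain ⟨ρ, η, C, hU⟩ := hb.uniformlyBunched
  obtain ⟨π, hπd⟩ : ∃ π, π = Function.minimalPeriod (shift (T := T)) p := ⟨_, rfl⟩
  have hπ : 0 < π := hπd ▸ Function.minimalPeriod_pos_of_mem_periodicPts hper
  have hp : (shift ^ π) p = p := by
    rw [hπd, ← Equiv.Perm.iterate_eq_pow]
    exact Function.isPeriodicPt_minimalPeriod _ _
  rw [← hπd] at hpin
  obtain ⟨r, hz⟩ := exists_agree_of_mem_homoclinicPoints hzh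
  obtain ⟨u, φ, t, hφu, ht, hlim, c, hc, hG⟩ := exists_dominant_pairing hd hpin htw
  obtain ⟨τ₀, hτ₀, hprox⟩ := exists_isEpsProximal_of_near hφu
  refine ⟨τ₀, hτ₀, fun τ hτ hττ₀ => ?_⟩
  obtain ⟨δ, hδ, hprox⟩ := hprox τ hτ hττ₀
  obtain ⟨ε, hε, hmain⟩ := exists_near_projection hc hG hδ
  obtain ⟨s₀, hs₀⟩ := hU.exists_near_holonomyLoop hz hε
  have hρ := hU.rho_pos
  have hη := hU.eta_pos
  have hD := hU.distConst_nonneg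
  -- The number `s` of periods makes the absorbed errors small, brings the truncated holonomies
  -- close to the loop, and exceeds the homoclinic radius `r`.
  obtain ⟨s, hsκ, hss₀, hsr⟩ := (((tendsto_const_mul_pow_mul
    (c := distConst η C * (ρ ^ r)⁻¹) hη.le hU.eta_lt_one hπ).eventually
    (gt_mem_nhds (show (0 : ℝ) < min 1 (ε / 3) by positivity))).and
    ((eventually_ge_atTop s₀).and (eventually_ge_atTop r))).exists
  set κ := distConst η C * (ρ ^ r)⁻¹ * η ^ (s * π) with hκ
  have hκ1 : κ ≤ 1 := hsκ.le.trans (min_le_left _ _)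
  have hκε : 3 * κ ≤ ε := by linarith [hsκ.le.trans (min_le_right _ _)]
  have hDκ : distConst η C * η ^ (s * π) ≤ κ := by
    have : 1 ≤ (ρ ^ r)⁻¹ := (one_le_inv₀ (by positivity)).2 (pow_le_one₀ hρ.le hU.rho_lt_one.le)
    rw [hκ]
    gcongr
    exact le_mul_of_one_le_right hD this
  -- The exponent `m` brings normalized `P^m` close to the projection and makes the unabsorbed outer
  -- errors small; `m > s` gives the strict margin `r < m π` used in closing the orbit.
  obtain ⟨m, hm1, hm2, hms⟩ := ((hlim.eventually (Metric.closedBall_mem_nhds _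
    (show (0 : ℝ) < min 1 (ε / 2) by positivity))).and (((tendsto_const_mul_pow_mul
    (c := distConst η C * (ρ ^ r)⁻¹ * (‖φ.smulRight u‖ + 1)) hρ.le hU.rho_lt_one hπ).eventually
    (gt_mem_nhds (show (0 : ℝ) < ε / 2 by positivity))).and
    (eventually_gt_atTop s))).exists
  rw [dist_eq_norm] at hm1
  have hm3 : distConst η C * ρ ^ (m * π - r) * (‖φ.smulRight u‖ + 1) ≤ ε / 2 := by
    refine le_trans ?_ hm2.le
    have := mul_le_mul_of_nonneg_left (hU.rho_pow_sub_le (m * π) r) hD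
    calc _ ≤ distConst η C * ((ρ ^ r)⁻¹ * ρ ^ (m * π)) * (‖φ.smulRight u‖ + 1) := by gcongr
      _ = _ := by ring
  have hsπ : s ≤ s * π := Nat.le_mul_of_pos_right s hπ
  have hmπ : m ≤ m * π := Nat.le_mul_of_pos_right m hπ
  refine ⟨2 * (m * π) + (2 * s + 2 * d) * π + 2 * (s * π) + 2 * M, fun x n => ?_⟩
  obtain ⟨y, hy1, hy2, hy3⟩ := exists_excursion hT hM p x n
  set P := (iter A π p).toOp with hP
  set S₀ := (iter A (2 * M + n + 2 * (s * π)) ((shift ^ (-((s * π : ℕ) : ℤ))) y)).toOp with hS₀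
  -- A composition of invertible maps is nonzero because the space contains `u ≠ 0`.
  have hG0 : P ^ s * S₀ * P ^ s ≠ 0 := by
    intro h0
    rw [hP, hS₀, ← toOp_pow, ← toOp_mul, ← toOp_mul] at h0
    have h1 : ∀ g : GLd d, g.toOp = 0 → u = 0 := fun g hg =>
      g.map_eq_zero_iff.1 (congrArg (fun f : Euc d →L[ℝ] Euc d => f u) hg)
    rw [h1 _ h0, map_zero] at hφu
    exact zero_ne_one hφu
  obtain ⟨l, hl, l', hl', hfin⟩ := hmain _ hG0
  have hsl : (s + l) * π = s * π + l * π := by ring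
  have hsl' : (s + l') * π = s * π + l' * π := by ring
  have hlπ : l * π ≤ d * π := by gcongr
  have hlπ' : l' * π ≤ d * π := by gcongr
  have hk : (2 * s + 2 * d) * π = 2 * (s * π) + 2 * (d * π) := by ring
  obtain ⟨q, hq, hq1, hq2, hq3⟩ := exists_periodic_shadow (z := z) (y := y) (r := r)
    (a := m * π) (b := (s + l) * π) (b' := (s + l') * π) (c := s * π) (D := 2 * M + n)
    (shift_pow_mul_eq hp _) (shift_pow_mul_eq hp _) (shift_pow_mul_eq hp _)
    (shift_pow_mul_eq hp _) hz hy1 (by exact_mod_cast hy3) (by omega) (by omega) (by omega)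
  obtain ⟨E₁, F₁, hE₁, hF₁, h₁⟩ := hU.segment_out (z := z) (r := r) (s := s) (m := m) (l := l)
    (q := q) hp (by omega) hq1
  obtain ⟨F₂, F₂', hF₂, hF₂', h₂⟩ := hU.segment_through (r := r) (s := s)
    (n := 2 * M + n + 2 * (s * π)) (x := (shift ^ (-((s * π : ℕ) : ℤ))) y)
    (q := (shift ^ ((s + l) * π + m * π)) q) hp (fun i hi hi' => by
      rw [shift_neg_pow_apply, shift_pow_apply, hq2 _ (by omega)
        (by omega)]
      push_cast
      ring_nf)
  obtain ⟨E₃, F₃, hE₃, hF₃, h₃⟩ := hU.segment_in (z := z) (r := r) (s := s) (m := m) (l := l')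
    (q := (shift ^ (2 * M + n + 2 * (s * π) + ((s + l) * π + m * π))) q) hp (by omega)
    (fun i hi hi' => by
      rw [shift_pow_apply, hq3 _ (by omega) (by omega)]
      push_cast
      ring_nf)
  -- In the last witness, the excursion starts after the first three summands, and the bridge of
  -- length `M` precedes the word of `x`.
  refine ⟨q, m * π + (s + l) * π + (2 * M + n + 2 * (s * π)) + ((s + l') * π + m * π), by omega,
    ?_, by omega, by omega, ?_, m * π + (s + l) * π + s * π + M, ?_⟩
  · rw [Function.IsPeriodicPt, Function.IsFixedPt, Equiv.Perm.iterate_eq_pow]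
    exact hq
  · have hLR := norm_perturb_sub_le (hm1.trans (min_le_right _ _)) (hm1.trans (min_le_left _ _))
      hE₃ hm3
    have hLR' := norm_perturb_sub_le (hm1.trans (min_le_right _ _)) (hm1.trans (min_le_left _ _))
      hE₁ hm3
    obtain ⟨t', ht'⟩ := hfin _ _ _ _ _ _ hLR.1 hLR'.2
      (hs₀ ((s + l) * π) (m * π) (by omega) (by omega))
      (hs₀ (m * π) ((s + l') * π) (by omega) (by omega))
      (norm_one_add_mul_one_add_sub_one_le hF₂ (hF₁.trans hDκ) hκ1 hκε)
      (norm_one_add_mul_one_add_sub_one_le (hF₃.trans hDκ) hF₂' hκ1 hκε)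
    rw [← smul_regroup t' ((t ^ m)⁻¹) h₂, ← h₁, ← h₃, ← toOp_mul, ← toOp_mul, ← iter_add,
      ← iter_add] at ht'
    have hnq : m * π + (s + l) * π + (2 * M + n + 2 * (s * π)) + ((s + l') * π + m * π) =
        m * π + (s + l') * π + (2 * M + n + 2 * (s * π) + ((s + l) * π + m * π)) := by ring
    rw [hnq]
    exact hprox _ _ ht'
  · intro i hi
    rw [shift_pow_apply, hq2 _ (by omega) (by omega),
      ← hy2 i (by omega) (by omega)]
    push_cast
    ring_nf

end Main

end ProximalCocycle

end

theorem mainTheorem6 {N : ℕ} (T : Matrix (Fin N) (Fin N) ℕ)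
    (hT : ∀ i j, T i j = 0 ∨ T i j = 1) (hprim : ∃ M : ℕ, 0 < M ∧ ∀ i j, 0 < (T ^ M) i j)
    {d : ℕ} (hd : 1 ≤ d) (A : Subshift T → GLd d) (hA : IsOneTypical A) :
    ∃ τ₀ : ℝ, 0 < τ₀ ∧ ∀ τ : ℝ, 0 < τ → τ < τ₀ →
      ∃ k : ℕ, ∀ (x : Subshift T) (n : ℕ),
        ∃ (q : Subshift T) (nq : ℕ), 0 < nq ∧ Function.IsPeriodicPt (shift (T := T)) nq q ∧
          n ≤ nq ∧ nq ≤ n + k ∧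
          IsEpsProximal τ (iter A nq q) ∧
          ∃ j : ℕ, (shift ^ j) q ∈ cylinder x n := by
  exact hA.exists_isEpsProximal_periodic hT hprim hd
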